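/- **Setting.** Let $u\cdot v$ be the bilinear Minkowski product on $\mathbb C^4$, let $n\ge 1$, $p_0,\dots,p_{n-1}\in\mathbb C^4$, $M_0,\dots,M_{n-1}\in\mathbb C$, and let $D_i=(q+p_i)^2-M_i^2-\mu^2$, a polynomial in the four components of $q$ and in $\mu^2$. The *rank* of such a polynomial is its degree when $\mu^2$ counts twice and each component of $q$ once. Assume generic kinematics: any at most five of the $p_i$ are affinely independent, and so are any at most six of the points $(p_i,\,p_i^2-M_i^2)\in\mathbb C^5$. Let $\mathcal N$ be a polynomial of rank at most $n$ and $\mathcal I_{0\cdots(n-1)}=\mathcal N/(D_0\cdots D_{n-1})$. For every cut $S=\{i_1<\dots<i_k\}\subseteq\{0,\dots,n-1\}$, $k\ge1$, fix vectors $e_1,\dots,e_4$ and write $q=-p_{i_1}+x_1e_1+x_2e_2+x_3e_3+x_4e_4$. Here, if $k\ge5$, the $e_j$ are linearly independent and are external momenta of the cut, i.e. differences $p_a-p_b$ with $a,b\in S$. If $k<5$, then $e_1^2=e_2^2=0$, $e_1\cdot e_2=1$, $e_3^2=e_4^2=\delta_{k4}$, $e_3\cdot e_4=-(1-\delta_{k4})$,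 and $e_1,e_2$ are orthogonal to $e_3,e_4$; moreover $e_4$ is orthogonal to all $p_a-p_b$ ($a,b\in S$) if $k\in\{2,3,4\}$, $e_3$ is so too if $k\in\{2,3\}$, and $e_1\cdot(p_{i_2}-p_{i_1})\ne0$ if $k=2$. Fix a monomial order on $(x_1,x_2,x_3,x_4,\mu^2)$ with $x_2\prec x_1$, $x_2^2\prec x_3x_4$, $\mu^2\prec x_3x_4$, $\mu^2\prec x_4^2$ (for instance lexicographic with $x_1>x_3>x_4>x_2>\mu^2$). A *recursive Gröbner division* of $\mathcal N$ consists of numerators $\mathcal N_S$ of rank at most $|S|$ for all $S\subseteq\{0,\dots,n-1\}$, with $\mathcal N_{\{0,\dots,n-1\}}=\mathcal N$, and, for $S\neq\emptyset$, residues $\Delta_S$ and polynomials $Q_{S,\kappa}$ ($\kappa\in S$) such that: in the coordinates of $S$, $\Delta_S$ is the remainder of the division of $\mathcal N_S$ modulo a Gröbner basis of the ideal $\langle D_i: i\in S\rangle$; $\mathcal N_S=\sum_{\kappa\in S}Q_{S,\kappa}D_\kappa+\Delta_S$; and for every proper subset $T$, $\mathcal N_T=\sum_{\kappa\notin T}Q_{T\cup\{\kappa\},\kappa}$,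 so that the numerator of a lower-point integrand collects the contributions of all the integrands from which it arises by removing one denominator. **Claim.** A recursive Gröbner division of $\mathcal N$ exists, and for every one of them $$\mathcal I_{0\cdots(n-1)}=\sum_{k=1}^{5}\ \sum_{0\le i_1<\dots<i_k\le n-1}\frac{\Delta_{i_1\cdots i_k}}{D_{i_1}\cdots D_{i_k}}$$ wherever no denominator vanishes; the residue of every cut with at least six denominators is $0$; and, with complex constants depending on the cut, in the coordinates of the cut, $$\Delta_{i_1\cdots i_5}=c_0,\qquad \Delta_{i_1\cdots i_4}=c_0+c_1x_4+\mu^2(c_2+c_3x_4+\mu^2c_4),$$ $$\Delta_{i_1i_2i_3}=c_0+c_1x_3+c_2x_3^2+c_3x_3^3+c_4x_4+c_5x_4^2+c_6x_4^3+\mu^2(c_7+c_8x_3+c_9x_4),$$ $$\Delta_{i_1i_2}=c_0+c_1x_2+c_2x_3+c_3x_4+c_4x_2^2+c_5x_3^2+c_6x_4^2+c_7x_2x_3+c_8x_2x_4+c_9\mu^2,$$ $$\Delta_{i_1}=\mathcal N_{i_1}=\beta_0+\sum_{j=1}^4\beta_jx_j .$$ -/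

import Mathlib

open scoped MonomialOrder

namespace OneLoop

noncomputable section

/-- The Minkowski product of signature `(+,-,-,-)`, bilinear over an arbitrary commutative ring
(complex momenta, or momenta whose components are indeterminates). -/
def minkowski {R : Type*} [CommRing R] (u v : Fin 4 → R) : R :=
  u 0 * v 0 - u 1 * v 1 - u 2 * v 2 - u 3 * v 3

/-- Complex four-momenta. -/
abbrev Momentum : Type := Fin 4 → ℂ

/-- Polynomials in five indeterminates over `ℂ`.  They are used with two meanings:
* loop variables: `X 0, …, X 3` are the components `q⁰, …, q³` of the four-dimensional part of the
  loop momentum, and `X 4` is `μ²`;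
* cut variables: `X 0, …, X 3` are the coordinates `x₁, …, x₄` of the loop momentum in
  a basis attached to a cut, and `X 4` is `μ²`. -/
abbrev LoopPoly : Type := MvPolynomial (Fin 5) ℂ

open MvPolynomial

/-- The rank of a numerator: `μ²` counts twice, every momentum component once. -/
def rank (f : LoopPoly) : ℕ :=
  weightedTotalDegree (![1, 1, 1, 1, 2] : Fin 5 → ℕ) f

/-- The denominator `D = (q̄ + p)² - M² = (q + p)² - M² - μ²`, in the loop variables. -/
def denominator (p : Momentum) (M : ℂ) : LoopPoly :=
  minkowski (fun ν : Fin 4 => (X ν.castSucc + C (p ν) : LoopPoly))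
      (fun ν : Fin 4 => (X ν.castSucc + C (p ν) : LoopPoly))
    - C (M ^ 2) - X 4

/-- Passage from the loop variables to the cut variables: the substitution
`q = -a + x₁ e₁ + x₂ e₂ + x₃ e₃ + x₄ e₄`, with `μ²` unchanged. -/
def toCut (a : Momentum) (e : Fin 4 → Momentum) : LoopPoly →ₐ[ℂ] LoopPoly :=
  aeval (Fin.snoc (α := fun _ => LoopPoly)
    (fun ν : Fin 4 => -C (a ν) + ∑ j : Fin 4, C (e j ν) * X j.castSucc) (X 4))

/-- The momentum `p_{i₁}`, where `i₁` is the least index of the cut `S = {i₁ < ⋯ < i_k}`. -/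
def cutOrigin {n : ℕ} (p : Fin n → Momentum) (S : Finset (Fin n)) (hS : S.Nonempty) : Momentum :=
  p (S.min' hS)

/-- Non-exceptional kinematics: the momenta of at most five denominators are in general position,
and so are the points `(p_i, p_i² - M_i²)` of `ℂ⁵` attached to at most six denominators. -/
structure GenericKinematics {n : ℕ} (p : Fin n → Momentum) (M : Fin n → ℂ) : Prop where
  momenta : ∀ S : Finset (Fin n), S.card ≤ 5 → AffineIndependent ℂ (fun i : S => p i)
  lifted : ∀ S : Finset (Fin n), S.card ≤ 6 →
    AffineIndependent ℂ (fun i : S => ((p i, minkowski (p i) (p i) - M i ^ 2) : Momentum × ℂ))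

/-- The table of products `e_i · e_j` prescribed for a basis of a `k`-fold cut, `k < 5`:
`e₁² = e₂² = 0`, `e₁ · e₂ = 1`, `e₃² = e₄² = δ_{k4}`, `e₃ · e₄ = -(1 - δ_{k4})`,
and `e₁, e₂` are orthogonal to `e₃, e₄`. -/
def cutGram (k : ℕ) : Matrix (Fin 4) (Fin 4) ℂ :=
  let δ : ℂ := if k = 4 then 1 else 0
  !![0, 1, 0, 0;
     1, 0, 0, 0;
     0, 0, δ, -(1 - δ);
     0, 0, -(1 - δ), δ]

/-- `e = (e₁, e₂, e₃, e₄)` is a basis adapted to the cut `S`.  The external momenta of the cut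
diagram are differences `p_a - p_b` with `a, b ∈ S`.  From five denominators on, the basis consists
of four external momenta; below, it satisfies the prescribed product table, and is completed by
vectors orthogonal to the external momenta (`e₄` for 4-fold cuts, `e₃` and `e₄` for 3-fold and
2-fold cuts).  For a 2-fold cut the only external momentum is not parallel to `e₁`. -/
structure IsCutBasis {n : ℕ} (p : Fin n → Momentum) (S : Finset (Fin n))
    (e : Fin 4 → Momentum) : Prop where
  linearIndependent : 5 ≤ S.card → LinearIndependent ℂ e
  external : 5 ≤ S.card → ∀ j, ∃ a ∈ S, ∃ b ∈ S, e j = p a - p b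
  gram : S.card < 5 → ∀ i j, minkowski (e i) (e j) = cutGram S.card i j
  orthogonal_four : S.card = 2 ∨ S.card = 3 ∨ S.card = 4 →
    ∀ a ∈ S, ∀ b ∈ S, minkowski (e 3) (p a - p b) = 0
  orthogonal_three : S.card = 2 ∨ S.card = 3 →
    ∀ a ∈ S, ∀ b ∈ S, minkowski (e 2) (p a - p b) = 0
  not_parallel : S.card = 2 →
    ∀ a ∈ S, ∀ b ∈ S, a ≠ b → minkowski (e 0) (p a - p b) ≠ 0

/-- Monomial orders on the cut variables with
`x₂ ≺ x₁`, `x₂² ≺ x₃ x₄`, `μ² ≺ x₃ x₄` and `μ² ≺ x₄²`;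
for instance the lexicographic order with `x₁ > x₃ > x₄ > x₂ > μ²`. -/
structure IsCutOrder (ord : MonomialOrder (Fin 5)) : Prop where
  x2_lt_x1 : (Finsupp.single 1 1 : Fin 5 →₀ ℕ) ≺[ord] Finsupp.single 0 1
  x2_sq_lt_x3x4 : (Finsupp.single 1 2 : Fin 5 →₀ ℕ) ≺[ord]
    (Finsupp.single 2 1 + Finsupp.single 3 1)
  mu_lt_x3x4 : (Finsupp.single 4 1 : Fin 5 →₀ ℕ) ≺[ord]
    (Finsupp.single 2 1 + Finsupp.single 3 1)
  mu_lt_x4_sq : (Finsupp.single 4 1 : Fin 5 →₀ ℕ) ≺[ord] Finsupp.single 3 2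

/-- `G` is a Gröbner basis of the ideal `J` for the monomial order `ord`. -/
structure IsGroebnerBasis (ord : MonomialOrder (Fin 5)) (J : Ideal LoopPoly)
    (G : Finset LoopPoly) : Prop where
  mem : ∀ g ∈ G, g ∈ J
  ne_zero : ∀ g ∈ G, g ≠ 0
  leading : ∀ f ∈ J, f ≠ 0 → ∃ g ∈ G, ord.degree g ≤ ord.degree f

/-- `r` is the remainder of the multivariate division of `f` modulo a Gröbner basis of `J`:
`f = ∑ Q_g g + r`, no product `Q_g g` has a leading monomial above that of `f`, and no monomial
of `r` is divisible by the leading monomial of an element of the Gröbner basis. -/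
def IsGroebnerRemainder (ord : MonomialOrder (Fin 5)) (J : Ideal LoopPoly)
    (f r : LoopPoly) : Prop :=
  ∃ G : Finset LoopPoly, IsGroebnerBasis ord J G ∧
    ∃ Q : LoopPoly → LoopPoly,
      f = ∑ g ∈ G, Q g * g + r ∧
      (∀ g ∈ G, ord.degree (Q g * g) ≼[ord] ord.degree f) ∧
      ∀ c ∈ r.support, ∀ g ∈ G, ¬ ord.degree g ≤ c

/-- The ideal generated by the denominators of the cut `S`, in the cut variables of `S`. -/
def cutIdeal {n : ℕ} (p : Fin n → Momentum) (M : Fin n → ℂ) (S : Finset (Fin n))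
    (hS : S.Nonempty) (e : Fin 4 → Momentum) : Ideal LoopPoly :=
  Ideal.span ((fun i => toCut (cutOrigin p S hS) e (denominator (p i) (M i))) '' (S : Set (Fin n)))

/-- A run of the recursive Gröbner division on the integrand with numerator `N₀` and all
denominators `D_0, …, D_{n-1}`.  `N S` is the numerator of the integrand with denominators `D_i`,
`i ∈ S`, `Δ S` is the residue of that cut, and `Q S κ` is the contribution of `N S` to
the numerator of the integrand in which the denominator `D_κ` has been pinched. -/
structure IsIntegrandReduction {n : ℕ} (p : Fin n → Momentum) (M : Fin n → ℂ)
    (e : Finset (Fin n) → Fin 4 → Momentum) (ord : MonomialOrder (Fin 5)) (N₀ : LoopPoly)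
    (N Δ : Finset (Fin n) → LoopPoly) (Q : Finset (Fin n) → Fin n → LoopPoly) : Prop where
  /-- The recursion starts from the given numerator. -/
  start : N Finset.univ = N₀
  /-- The residue is the remainder of the division modulo a Gröbner basis of the cut. -/
  division : ∀ (S : Finset (Fin n)) (hS : S.Nonempty),
    IsGroebnerRemainder ord (cutIdeal p M S hS (e S))
      (toCut (cutOrigin p S hS) (e S) (N S)) (toCut (cutOrigin p S hS) (e S) (Δ S))
  /-- The rest of the numerator is written in terms of the denominators of the cut. -/
  pinch : ∀ S : Finset (Fin n), S.Nonempty →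
    N S = ∑ κ ∈ S, Q S κ * denominator (p κ) (M κ) + Δ S
  /-- The numerator of a lower integrand collects all the contributions from the integrands with
  one more denominator. -/
  collect : ∀ T : Finset (Fin n), T ≠ Finset.univ →
    N T = ∑ κ ∈ Finset.univ \ T, Q (insert κ T) κ
  /-- The numerator of an integrand with `k` denominators has rank at most `k`. -/
  rank_le : ∀ S : Finset (Fin n), rank (N S) ≤ S.card

end

end OneLoop

/-! All denominators of a cut share one quadratic part, so their differences are affine in the cut
variables. For two to five denominators these `k - 1` differences solve for `k - 1` coordinates:
constants for `k ≥ 3`, by general position of the momenta; for `k = 2`, `x₁` as an affine function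
of `x₂`, because `e₁` is not orthogonal to the external momentum. Substituting in one denominator
leaves a single quadric, whose leading monomial is `μ²`, `x₄²`, `x₃x₄`, `x₃x₄` for `k = 5, 4, 3, 2`,
and has weight two for `k = 1`. The affine functions and the quadric form a Gröbner basis
(`IsQuadricSystem.isGroebnerBasis`), because elimination sends the ideal into the principal ideal of
the quadric.

The monomial order need not be graded, so division alone does not control ranks. But the affine
functions are constant combinations of the denominators, the quadric is a combination with
coefficients of rank at most one, and neither has a term heavier than its leading one. Hence
`exists_reduction` yields quotients of rank at most `k - 1` and a remainder of rank at most `k`. By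
uniqueness of remainders (`IsGroebnerRemainder.eq_of_reduced`) the bound holds for every recursive
division, and the residues are spanned by the monomials of weight at most `k` not divisible by a
leading monomial.

For six or more denominators, general position of the lifted points gives constant combinations
equal to `1` and to each component of `q`, hence also `μ²` with coefficients of rank at most one
(`exists_six_combinations`). The residue is zero, and the numerator is a combination of the
denominators with quotients of rank at most `k - 1`, so the recursion can always continue.

The decomposition is a telescoping sum over all cuts (`IsIntegrandReduction.sum_residues`). Its only
leftover is the numerator of the empty cut, which vanishes because a one-point numerator is already
reduced. -/

namespace OneLoop

open MvPolynomial

noncomputable section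

section

/-! ### Rank -/

/-- The weight of an exponent: `μ²` counts twice, every momentum component once. -/
abbrev wt (c : Fin 5 →₀ ℕ) : ℕ := Finsupp.weight (![1, 1, 1, 1, 2] : Fin 5 → ℕ) c

theorem wt_eq (c : Fin 5 →₀ ℕ) : wt c = c 0 + c 1 + c 2 + c 3 + 2 * c 4 := by
  rw [wt, Finsupp.weight_apply, Finsupp.sum_fintype _ _ (by simp)]
  simp [Fin.sum_univ_succ]
  ring

theorem rank_le_iff {f : LoopPoly} {k : ℕ} : rank f ≤ k ↔ ∀ c ∈ f.support, wt c ≤ k := by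
  simp only [rank, weightedTotalDegree, Finset.sup_le_iff]

theorem wt_le_rank {f : LoopPoly} {c : Fin 5 →₀ ℕ} (hc : c ∈ f.support) : wt c ≤ rank f :=
  rank_le_iff.1 le_rfl c hc

theorem rank_zero : rank 0 = 0 := by simp [rank, weightedTotalDegree]

theorem rank_monomial_le (c : Fin 5 →₀ ℕ) (a : ℂ) : rank (monomial c a) ≤ wt c := by
  rw [rank_le_iff]
  intro d hd
  rw [Finset.mem_singleton.1 (support_monomial_subset hd)]

theorem rank_C (a : ℂ) : rank (C a) = 0 := by
  simpa using rank_monomial_le 0 a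

theorem rank_X_castSucc_le (j : Fin 4) : rank (X j.castSucc) ≤ 1 := by
  refine (rank_monomial_le _ _).trans ?_
  fin_cases j <;> simp [wt_eq]

theorem rank_X_last_le : rank (X 4) ≤ 2 := by
  refine (rank_monomial_le _ _).trans ?_
  simp [wt_eq]

theorem rank_add_le {f g : LoopPoly} {k : ℕ} (hf : rank f ≤ k) (hg : rank g ≤ k) :
    rank (f + g) ≤ k := by
  classical
  rw [rank_le_iff] at *
  intro c hc
  exact (Finset.mem_union.1 (support_add hc)).elim (hf c) (hg c)

theorem rank_neg (f : LoopPoly) : rank (-f) = rank f := by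
  simp [rank, weightedTotalDegree]

theorem rank_sub_le {f g : LoopPoly} {k : ℕ} (hf : rank f ≤ k) (hg : rank g ≤ k) :
    rank (f - g) ≤ k := by
  rw [sub_eq_add_neg]
  exact rank_add_le hf ((rank_neg g).trans_le hg)

theorem rank_sum_le {ι : Type*} (s : Finset ι) {f : ι → LoopPoly} {k : ℕ}
    (hf : ∀ i ∈ s, rank (f i) ≤ k) : rank (∑ i ∈ s, f i) ≤ k := by
  classical
  induction s using Finset.induction_on with
  | empty => simp [rank_zero]
  | insert a s ha ih =>
    rw [Finset.sum_insert ha]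
    exact rank_add_le (hf a (by simp)) (ih fun i hi => hf i (by simp [hi]))

theorem rank_mul_le (f g : LoopPoly) : rank (f * g) ≤ rank f + rank g := by
  classical
  rw [rank_le_iff]
  intro c hc
  obtain ⟨a, ha, b, hb, rfl⟩ := Finset.mem_add.1 (support_mul f g hc)
  rw [wt, map_add]
  exact add_le_add (wt_le_rank ha) (wt_le_rank hb)

theorem rank_mul_le_of_le {f g : LoopPoly} {k l m : ℕ} (hf : rank f ≤ k) (hg : rank g ≤ l)
    (h : k + l ≤ m) : rank (f * g) ≤ m :=
  (rank_mul_le f g).trans ((add_le_add hf hg).trans h)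

theorem rank_pow_le {f : LoopPoly} {k : ℕ} (hf : rank f ≤ k) (n : ℕ) : rank (f ^ n) ≤ n * k := by
  induction n with
  | zero => simpa using (rank_C 1).le
  | succ n ih =>
    rw [pow_succ]
    exact rank_mul_le_of_le ih hf (by ring_nf; rfl)

theorem rank_C_mul_le (a : ℂ) {f : LoopPoly} {k : ℕ} (hf : rank f ≤ k) : rank (C a * f) ≤ k :=
  rank_mul_le_of_le (rank_C a).le hf (by simp)

/-- A substitution that does not raise the ranks of the variables does not raise ranks. -/
theorem rank_aeval_le {y : Fin 5 → LoopPoly}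
    (hy : ∀ i, rank (y i) ≤ (![1, 1, 1, 1, 2] : Fin 5 → ℕ) i) (f : LoopPoly) :
    rank (aeval y f) ≤ rank f := by
  rw [aeval_def, eval₂_eq']
  refine rank_sum_le _ fun c hc => ?_
  refine rank_C_mul_le _ (le_trans ?_ (wt_le_rank hc))
  rw [wt_eq, Fin.prod_univ_five]
  have h (i : Fin 5) := rank_pow_le (hy i) (c i)
  refine rank_mul_le_of_le (rank_mul_le_of_le (rank_mul_le_of_le (rank_mul_le_of_le
    (h 0) (h 1) le_rfl) (h 2) le_rfl) (h 3) le_rfl) (h 4) ?_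
  simp
  omega

/-! ### Gröbner bases -/

variable {ord : MonomialOrder (Fin 5)} {J : Ideal LoopPoly}

theorem exists_division (ord : MonomialOrder (Fin 5)) {G : Finset LoopPoly}
    (hG : ∀ g ∈ G, g ≠ 0) (f : LoopPoly) :
    ∃ (Q : LoopPoly → LoopPoly) (r : LoopPoly), f = ∑ g ∈ G, Q g * g + r ∧
      (∀ g ∈ G, ord.degree (Q g * g) ≼[ord] ord.degree f) ∧
      ∀ c ∈ r.support, ∀ g ∈ G, ¬ ord.degree g ≤ c := by
  classical
  obtain ⟨q, r, h1, h2, h3⟩ := MonomialOrder.div_set (m := ord) (B := (G : Set LoopPoly))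
    (fun b hb => MonomialOrder.isUnit_leadingCoeff.2 (hG b hb)) f
  refine ⟨fun g => if h : g ∈ G then q ⟨g, h⟩ else 0, r, ?_, ?_, h3⟩
  · rw [h1, Finsupp.linearCombination_apply, Finsupp.sum_fintype _ _ (by simp)]
    congr 1
    rw [← Finset.sum_coe_sort G]
    exact Finset.sum_congr rfl fun x _ => by simp
  · intro g hg
    simpa [hg, mul_comm] using h2 ⟨g, hg⟩

/-- A finite set of nonzero elements of `J` is a Gröbner basis as soon as no nonzero element
of `J` is reduced with respect to it. -/
theorem isGroebnerBasis_of_reduced_eq_zero {G : Finset LoopPoly} (hJ : ∀ g ∈ G, g ∈ J)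
    (hG : ∀ g ∈ G, g ≠ 0)
    (h : ∀ r ∈ J, (∀ c ∈ r.support, ∀ g ∈ G, ¬ ord.degree g ≤ c) → r = 0) :
    IsGroebnerBasis ord J G := by
  refine ⟨hJ, hG, fun f hf hf0 => ?_⟩
  obtain ⟨Q, r, h1, h2, h3⟩ := exists_division ord hG f
  have hr : r = 0 := h r (by
    rw [show r = f - ∑ g ∈ G, Q g * g by rw [h1]; simp]
    exact J.sub_mem hf (J.sum_mem fun g hg => J.mul_mem_left _ (hJ g hg))) h3
  rw [hr, add_zero] at h1
  have hmem : ord.degree f ∈ f.support := (ord.degree_mem_support_iff f).2 hf0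
  -- The remainder is zero, so the leading monomial of `f` must occur in one of the products; the
  -- degree bound of the division then makes it the leading monomial of that product.
  obtain ⟨g, hg, hgc⟩ : ∃ g ∈ G, coeff (ord.degree f) (Q g * g) ≠ 0 := by
    by_contra! hc
    refine mem_support_iff.1 hmem ?_
    nth_rewrite 2 [h1]
    rw [coeff_sum]
    exact Finset.sum_eq_zero hc
  refine ⟨g, hg, ?_⟩
  have hQg : Q g * g ≠ 0 := fun h0 => hgc (by simp [h0])
  have heq : ord.degree (Q g * g) = ord.degree f :=
    ord.toSyn.injective (le_antisymm (h2 g hg) (ord.le_degree (mem_support_iff.2 hgc)))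
  rw [← heq, MonomialOrder.degree_mul' hQg]
  exact le_add_self

theorem exists_isGroebnerRemainder {G : Finset LoopPoly} (hG : IsGroebnerBasis ord J G)
    (f : LoopPoly) : ∃ r, IsGroebnerRemainder ord J f r := by
  obtain ⟨Q, r, h1, h2, h3⟩ := exists_division ord hG.ne_zero f
  exact ⟨r, G, hG, Q, h1, h2, h3⟩

/-- The remainder modulo a Gröbner basis of `J` depends only on `J` and the monomial order. -/
theorem IsGroebnerRemainder.eq_of_reduced {G : Finset LoopPoly} (hG : IsGroebnerBasis ord J G)
    {f r s : LoopPoly} (hr : IsGroebnerRemainder ord J f r) (hs : f - s ∈ J)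
    (hsG : ∀ c ∈ s.support, ∀ g ∈ G, ¬ ord.degree g ≤ c) : r = s := by
  classical
  obtain ⟨G', hG', Q, h1, -, h3⟩ := hr
  by_contra hne
  have hmem : r - s ∈ J := by
    have : f - r ∈ J := by
      rw [h1, add_sub_cancel_right]
      exact J.sum_mem fun g hg => J.mul_mem_left _ (hG'.mem g hg)
    simpa using J.sub_mem hs this
  have h0 : r - s ≠ 0 := sub_ne_zero.2 hne
  -- The leading monomial of `r - s` is divisible by a leading monomial from each of the two bases,
  -- yet it occurs in `r` or in `s`, each reduced for one of them.
  obtain ⟨g, hg, hgd⟩ := hG.leading _ hmem h0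
  obtain ⟨g', hg', hgd'⟩ := hG'.leading _ hmem h0
  rcases Finset.mem_union.1 (support_sub _ r s ((ord.degree_mem_support_iff _).2 h0)) with h | h
  · exact h3 _ h _ hg' hgd'
  · exact hsG _ h _ hg hgd

/-- Rank-controlled division.  If every exponent of weight at most `k` outside `B` is divisible by
the leading exponent of a combination of the `D i` of small rank, then every polynomial of rank at
most `k` is reducible to one with exponents in `B`, with quotients of rank below `k`. -/
theorem exists_reduction {ι : Type*} (ord : MonomialOrder (Fin 5)) (I : Finset ι)
    (D : ι → LoopPoly) (k : ℕ) (B : (Fin 5 →₀ ℕ) → Prop)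
    (hB : ∀ c, wt c ≤ k → ¬ B c → ∃ (h : ι → LoopPoly) (m : Fin 5 →₀ ℕ), m ≤ c ∧
      ∑ i ∈ I, h i * D i ≠ 0 ∧ ord.degree (∑ i ∈ I, h i * D i) = m ∧
      rank (∑ i ∈ I, h i * D i) ≤ wt m ∧ ∀ i ∈ I, wt (c - m) + rank (h i) ≤ k - 1)
    (f : LoopPoly) (hf : rank f ≤ k) :
    ∃ (Q : ι → LoopPoly) (r : LoopPoly), f = ∑ i ∈ I, Q i * D i + r ∧
      (∀ i ∈ I, rank (Q i) ≤ k - 1) ∧ rank r ≤ k ∧ ∀ c ∈ r.support, B c := by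
  classical
  let P : LoopPoly → Prop := fun f => ∃ (Q : ι → LoopPoly) (r : LoopPoly),
    f = ∑ i ∈ I, Q i * D i + r ∧
      (∀ i ∈ I, rank (Q i) ≤ k - 1) ∧ rank r ≤ k ∧ ∀ c ∈ r.support, B c
  have hP0 : P 0 := ⟨0, 0, by simp, by simp [rank_zero], by simp [rank_zero], by simp⟩
  have hPadd : ∀ f g, P f → P g → P (f + g) := by
    rintro f g ⟨Q, r, h1, h2, h3, h4⟩ ⟨Q', r', h1', h2', h3', h4'⟩
    refine ⟨fun i => Q i + Q' i, r + r', ?_, fun i hi => rank_add_le (h2 i hi) (h2' i hi),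
      rank_add_le h3 h3', fun c hc => ?_⟩
    · rw [h1, h1']
      simp only [add_mul, Finset.sum_add_distrib]
      ring
    · exact (Finset.mem_union.1 (support_add hc)).elim (h4 c) (h4' c)
  have hPsum : ∀ (f : LoopPoly), (∀ c ∈ f.support, ∀ a, P (monomial c a)) → P f := by
    intro f hf
    rw [f.as_sum]
    exact Finset.sum_induction _ P hPadd hP0 fun c hc => hf c hc _
  -- The induction runs along the monomial order, which may ignore weights; the bound `wt c ≤ k` is
  -- therefore carried along.
  have hmono : ∀ (s : ord.syn) (c : Fin 5 →₀ ℕ), ord.toSyn c = s → wt c ≤ k →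
      ∀ a, P (monomial c a) := by
    intro s
    induction s using WellFoundedLT.induction with
    | ind s ih =>
    rintro c rfl hc a
    by_cases hBc : B c
    · refine ⟨0, monomial c a, by simp, by simp [rank_zero], (rank_monomial_le c a).trans hc, ?_⟩
      intro d hd
      rwa [Finset.mem_singleton.1 (support_monomial_subset hd)]
    obtain ⟨h, m, hm, hg0, hgm, hgr, hh⟩ := hB c hc hBc
    set g := ∑ i ∈ I, h i * D i with hg
    set l := ord.leadingCoeff g
    have hl : l ≠ 0 := MonomialOrder.leadingCoeff_ne_zero_iff.2 hg0
    have hwt : wt (c - m) + wt m = wt c := by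
      rw [wt, wt, ← map_add, tsub_add_cancel_of_le hm]
    have hcoeff : coeff c (monomial (c - m) (a / l) * g) = a := by
      have := coeff_monomial_mul m (c - m) (a / l) g
      rw [tsub_add_cancel_of_le hm] at this
      rw [this, ← hgm]
      exact div_mul_cancel₀ a hl
    -- Subtracting the scaled `g` cancels the exponent `c`. What is left lies strictly below `c`,
    -- and is no heavier than `c` because `g` has rank at most `wt m`.
    have hrest : P (monomial c a - monomial (c - m) (a / l) * g) := by
      refine hPsum _ fun d hd b => ?_
      have hdc : d ≠ c := by
        rintro rfl
        refine mem_support_iff.1 hd ?_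
        rw [coeff_sub, hcoeff]
        simp
      have hd' : d ∈ (monomial (c - m) (a / l) * g).support := by
        rcases Finset.mem_union.1 (support_sub _ _ _ hd) with h | h
        · exact absurd (Finset.mem_singleton.1 (support_monomial_subset h)) hdc
        · exact h
      refine ih (ord.toSyn d) ?_ d rfl ?_ b
      · refine lt_of_le_of_ne ((ord.le_degree hd').trans
          (MonomialOrder.degree_mul_le.trans ?_)) fun h => hdc (ord.toSyn.injective h)
        rw [map_add, hgm]
        refine (add_le_add_left (MonomialOrder.degree_monomial_le _) _).trans_eq ?_
        rw [← map_add, tsub_add_cancel_of_le hm]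
      · refine (wt_le_rank hd').trans ?_
        exact rank_mul_le_of_le (rank_monomial_le _ _) hgr (hwt.le.trans hc)
    have hlead : P (monomial (c - m) (a / l) * g) := by
      refine ⟨fun i => monomial (c - m) (a / l) * h i, 0, ?_, fun i hi => ?_, by simp [rank_zero],
        by simp⟩
      · simp only [hg, Finset.mul_sum, mul_assoc, add_zero]
      · exact rank_mul_le_of_le (rank_monomial_le _ _) le_rfl (hh i hi)
    simpa using hPadd _ _ hrest hlead
  exact hPsum f fun c hc a => hmono _ c rfl (rank_le_iff.1 hf c hc) a

end

/-! ### Quadric systems: affine eliminations and one quadric -/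

section

/-- The polynomials `D i`, `i ∈ I`, cut out a quadric in an affine space: modulo the affine
functions `X j - y j`, `j ∈ E`, which are constant combinations of the `D i`, all of them agree with
a quadratic polynomial in the remaining variables, whose leading exponent is `m`. -/
structure IsQuadricSystem {ι : Type*} (ord : MonomialOrder (Fin 5)) (I : Finset ι)
    (D : ι → LoopPoly) (E : Finset (Fin 4)) (m : Fin 5 →₀ ℕ) (o : ι)
    (A : Matrix (Fin 4) (Fin 4) ℂ) (c : ℂ) (y : Fin 4 → LoopPoly) : Prop where
  mem : o ∈ I
  symm : ∀ i j, A i j = A j i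
  origin : D o = ∑ i : Fin 4, ∑ j : Fin 4, C (A i j) * (X i.castSucc * X j.castSucc) - C c - X 4
  eq_X : ∀ j ∉ E, y j = X j.castSucc
  rank_le : ∀ j, rank (y j) ≤ 1
  idem : ∀ j, aeval (Fin.snoc (α := fun _ => LoopPoly) y (X 4) : Fin 5 → LoopPoly) (y j) = y j
  degree_lt : ∀ j ∈ E, ord.degree (y j) ≺[ord] Finsupp.single j.castSucc 1
  linear : ∀ j ∈ E, ∃ h : ι → ℂ, X j.castSucc - y j = ∑ i ∈ I, C (h i) * D i
  diff : ∀ i ∈ I, ∃ b : Fin 4 → ℂ, D i = D o + ∑ j, C (b j) * (X j.castSucc - y j)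
  degree_quadric :
    ord.degree (∑ i : Fin 4, ∑ j : Fin 4, C (A i j) * (y i * y j) - C c - X 4) = m
  wt_degree : wt m = 2

namespace IsQuadricSystem

variable {ι : Type*} {ord : MonomialOrder (Fin 5)} {I : Finset ι}
    {D : ι → LoopPoly} {E : Finset (Fin 4)} {m : Fin 5 →₀ ℕ} {o : ι}
    {A : Matrix (Fin 4) (Fin 4) ℂ} {c : ℂ} {y : Fin 4 → LoopPoly}

/-- The quadratic polynomial of the system, in the variables that are not eliminated. -/
def quadric (A : Matrix (Fin 4) (Fin 4) ℂ) (c : ℂ) (y : Fin 4 → LoopPoly) : LoopPoly :=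
  ∑ i : Fin 4, ∑ j : Fin 4, C (A i j) * (y i * y j) - C c - X 4

/-- Elimination of the variables `X j`, `j ∈ E`. -/
def eliminate (y : Fin 4 → LoopPoly) : LoopPoly →ₐ[ℂ] LoopPoly :=
  aeval (Fin.snoc (α := fun _ => LoopPoly) y (X 4) : Fin 5 → LoopPoly)

theorem eliminate_X_castSucc (y : Fin 4 → LoopPoly) (j : Fin 4) :
    eliminate y (X j.castSucc) = y j := by
  rw [eliminate, aeval_X, Fin.snoc_castSucc]

theorem eliminate_X_last (y : Fin 4 → LoopPoly) : eliminate y (X 4) = X 4 := by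
  rw [eliminate, aeval_X]
  exact Fin.snoc_last (α := fun _ => LoopPoly) _ _

theorem eliminate_C (y : Fin 4 → LoopPoly) (a : ℂ) : eliminate y (C a) = C a := by
  rw [eliminate, aeval_C, algebraMap_eq]

theorem eliminate_origin (h : IsQuadricSystem ord I D E m o A c y) :
    eliminate y (D o) = quadric A c y := by
  simp only [h.origin, map_sub, map_sum, map_mul, quadric]
  simp only [eliminate_X_last y, eliminate_C y, eliminate_X_castSucc y]

/-- Elimination kills every `X j - y j`, since it fixes `y j`; hence all denominators collapse to
the same quadric. -/
theorem eliminate_eq (h : IsQuadricSystem ord I D E m o A c y) {i : ι} (hi : i ∈ I) :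
    eliminate y (D i) = quadric A c y := by
  obtain ⟨b, hb⟩ := h.diff i hi
  have hy (j) : eliminate y (y j) = y j := h.idem j
  rw [hb, map_add, h.eliminate_origin, map_sum]
  simp [eliminate_X_castSucc, hy]

theorem eliminate_eq_self (h : IsQuadricSystem ord I D E m o A c y) {r : LoopPoly}
    (hr : ∀ d ∈ r.support, ∀ j ∈ E, d j.castSucc = 0) : eliminate y r = r := by
  conv_rhs => rw [← aeval_X_left_apply r]
  refine hom_congr_vars (f₁ := (eliminate y).toRingHom) (f₂ := (aeval X : LoopPoly →ₐ[ℂ] _).toRingHom)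
    ?_ ?_ rfl
  · ext1 a
    simp [algebraMap_eq]
  · intro i hi _
    obtain ⟨d, hd, hdi⟩ := (mem_vars_iff_mem_support _).1 hi
    induction i using Fin.lastCases with
    | last => simpa using eliminate_X_last y
    | cast j =>
      have hj : j ∉ E := fun hj => Finsupp.mem_support_iff.1 hdi (hr d hd j hj)
      simpa [eliminate_X_castSucc] using h.eq_X j hj

theorem quadric_ne_zero (h : IsQuadricSystem ord I D E m o A c y) : quadric A c y ≠ 0 := by
  intro h0
  have h1 := h.degree_quadric
  have h2 := h.wt_degree
  rw [quadric] at h0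
  rw [h0, MonomialOrder.degree_zero] at h1
  rw [← h1] at h2
  simp at h2

theorem degree_linear (h : IsQuadricSystem ord I D E m o A c y) {j : Fin 4} (hj : j ∈ E) :
    ord.degree (X j.castSucc - y j) = Finsupp.single j.castSucc 1 := by
  rw [MonomialOrder.degree_sub_of_lt, MonomialOrder.degree_X]
  rw [MonomialOrder.degree_X]
  exact h.degree_lt j hj

theorem linear_ne_zero (h : IsQuadricSystem ord I D E m o A c y) {j : Fin 4} (hj : j ∈ E) :
    X j.castSucc - y j ≠ 0 := by
  refine ord.ne_zero_of_degree_ne_zero ?_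
  rw [h.degree_linear hj]
  simp

theorem rank_quadric_le (h : IsQuadricSystem ord I D E m o A c y) : rank (quadric A c y) ≤ 2 := by
  refine rank_sub_le (rank_sub_le (rank_sum_le _ fun i _ => rank_sum_le _ fun j _ => ?_) ?_) ?_
  · exact rank_C_mul_le _ (rank_mul_le_of_le (h.rank_le i) (h.rank_le j) le_rfl)
  · rw [rank_C]; omega
  · exact rank_X_last_le

/-- `D o` and the quadric are the same symmetric form evaluated at `X` and at `y`, so their
difference factors as `A(X + y, X - y)`. The factors `X - y` are constant combinations of the
denominators, and `X + y` supplies coefficients of rank at most one. -/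
theorem exists_quadric_eq (h : IsQuadricSystem ord I D E m o A c y) :
    ∃ q : ι → LoopPoly, (∀ i, rank (q i) ≤ 1) ∧ quadric A c y = ∑ i ∈ I, q i * D i := by
  classical
  have hlin : ∀ j, ∃ b : ι → ℂ, X j.castSucc - y j = ∑ i ∈ I, C (b i) * D i := by
    intro j
    by_cases hj : j ∈ E
    · exact h.linear j hj
    · exact ⟨0, by simp [h.eq_X j hj]⟩
  choose b hb using hlin
  let a : Fin 4 → LoopPoly := fun i => ∑ j : Fin 4, C (A i j) * (X j.castSucc + y j)
  have ha : ∀ i, rank (a i) ≤ 1 := fun i => rank_sum_le _ fun j _ =>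
    rank_C_mul_le _ (rank_add_le (rank_X_castSucc_le j) (h.rank_le j))
  have hdiff : D o - quadric A c y = ∑ i, a i * (X i.castSucc - y i) := by
    have hs : ∑ i : Fin 4, ∑ j : Fin 4, C (A i j) * (y i * X j.castSucc : LoopPoly) =
        ∑ i : Fin 4, ∑ j : Fin 4, C (A i j) * (X i.castSucc * y j : LoopPoly) := by
      rw [Finset.sum_comm]
      refine Finset.sum_congr rfl fun i _ => Finset.sum_congr rfl fun j _ => ?_
      rw [h.symm, mul_comm (y j)]
    have ht : ∑ i, a i * (X i.castSucc - y i) =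
        ∑ i : Fin 4, ∑ j : Fin 4, C (A i j) * (X i.castSucc * X j.castSucc : LoopPoly)
        - ∑ i : Fin 4, ∑ j : Fin 4, C (A i j) * (y i * y j : LoopPoly)
        + (∑ i : Fin 4, ∑ j : Fin 4, C (A i j) * (X i.castSucc * y j : LoopPoly)
        - ∑ i : Fin 4, ∑ j : Fin 4, C (A i j) * (y i * X j.castSucc : LoopPoly)) := by
      simp only [a, ← Finset.sum_sub_distrib, ← Finset.sum_add_distrib, Finset.sum_mul]
      refine Finset.sum_congr rfl fun i _ => Finset.sum_congr rfl fun j _ => ?_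
      ring
    rw [ht, hs, h.origin, quadric]
    ring
  refine ⟨fun i => (if i = o then 1 else 0) - ∑ j, a j * C (b j i), fun i => ?_, ?_⟩
  · refine rank_sub_le ?_ (rank_sum_le _ fun j _ =>
      rank_mul_le_of_le (ha j) (rank_C _).le le_rfl)
    split_ifs
    · exact (rank_C 1).trans_le zero_le_one
    · simp [rank_zero]
  · have h1 : quadric A c y = D o - ∑ i, a i * (X i.castSucc - y i) := by rw [← hdiff]; ring
    rw [h1]
    simp only [sub_mul, Finset.sum_sub_distrib, ite_mul, one_mul, zero_mul, Finset.sum_ite_eq',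
      h.mem, if_true, Finset.sum_mul, hb, Finset.mul_sum]
    rw [Finset.sum_comm]
    simp only [mul_assoc]

/-- The affine functions and the quadric of the system. -/
def basis (E : Finset (Fin 4)) (A : Matrix (Fin 4) (Fin 4) ℂ) (c : ℂ) (y : Fin 4 → LoopPoly) :
    Finset LoopPoly := by
  classical exact insert (quadric A c y) (E.image fun j => X j.castSucc - y j)

theorem mem_basis {g : LoopPoly} :
    g ∈ basis E A c y ↔ g = quadric A c y ∨ ∃ j ∈ E, X j.castSucc - y j = g := by
  classical
  simp [basis]

theorem not_degree_le (h : IsQuadricSystem ord I D E m o A c y) {d : Fin 5 →₀ ℕ} :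
    (∀ g ∈ basis E A c y, ¬ ord.degree g ≤ d) ↔ (∀ j ∈ E, d j.castSucc = 0) ∧ ¬ m ≤ d := by
  have hq : ord.degree (quadric A c y) = m := h.degree_quadric
  constructor
  · intro hd
    refine ⟨fun j hj => ?_, fun hm => hd _ (mem_basis.2 (Or.inl rfl)) (hq.trans_le hm)⟩
    have := hd _ (mem_basis.2 (Or.inr ⟨j, hj, rfl⟩))
    rw [h.degree_linear hj, Finsupp.single_le_iff] at this
    omega
  · rintro ⟨h1, h2⟩ g hg hgd
    rcases mem_basis.1 hg with rfl | ⟨j, hj, rfl⟩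
    · exact h2 (hq.symm.trans_le hgd)
    · rw [h.degree_linear hj, Finsupp.single_le_iff, h1 j hj] at hgd
      omega

/-- A reduced element of the ideal involves no eliminated variable, so elimination fixes it.
Elimination also sends the ideal into the multiples of the quadric, so the element is such a
multiple; if nonzero, its leading exponent would be at least `m`. -/
theorem isGroebnerBasis (h : IsQuadricSystem ord I D E m o A c y) :
    IsGroebnerBasis ord (Ideal.span (D '' (I : Set ι))) (basis E A c y) := by
  have hD : ∀ i ∈ I, D i ∈ Ideal.span (D '' (I : Set ι)) := fun i hi =>
    Ideal.subset_span ⟨i, hi, rfl⟩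
  refine isGroebnerBasis_of_reduced_eq_zero ?_ ?_ ?_
  · intro g hg
    rcases mem_basis.1 hg with rfl | ⟨j, hj, rfl⟩
    · obtain ⟨q, -, hq⟩ := h.exists_quadric_eq
      rw [hq]
      exact Ideal.sum_mem _ fun i hi => Ideal.mul_mem_left _ _ (hD i hi)
    · obtain ⟨b, hb⟩ := h.linear j hj
      rw [hb]
      exact Ideal.sum_mem _ fun i hi => Ideal.mul_mem_left _ _ (hD i hi)
  · intro g hg
    rcases mem_basis.1 hg with rfl | ⟨j, hj, rfl⟩
    · exact h.quadric_ne_zero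
    · exact h.linear_ne_zero hj
  · intro r hr hred
    have hred' := fun d hd => h.not_degree_le.1 (hred d hd)
    have hle : Ideal.span (D '' (I : Set ι)) ≤
        (Ideal.span {quadric A c y}).comap (eliminate y).toRingHom := by
      rw [Ideal.span_le]
      rintro _ ⟨i, hi, rfl⟩
      exact Ideal.mem_span_singleton.2 (h.eliminate_eq hi).symm.dvd
    have hdvd : quadric A c y ∣ r := by
      have := Ideal.mem_span_singleton.1 (hle hr)
      exact this.trans (h.eliminate_eq_self fun d hd => (hred' d hd).1).dvd
    obtain ⟨q, rfl⟩ := hdvd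
    by_contra h0
    refine hred _ ((ord.degree_mem_support_iff _).2 h0) _ (mem_basis.2 (Or.inl rfl)) ?_
    rw [MonomialOrder.degree_mul' h0]
    exact le_self_add

/-- An affine function removes weight one with constant coefficients, and the quadric removes weight
two with coefficients of rank at most one. Either way the quotients lose one unit of rank. -/
theorem exists_reduction (h : IsQuadricSystem ord I D E m o A c y) {k : ℕ} {f : LoopPoly}
    (hf : rank f ≤ k) :
    ∃ (Q : ι → LoopPoly) (r : LoopPoly), f = ∑ i ∈ I, Q i * D i + r ∧
      (∀ i ∈ I, rank (Q i) ≤ k - 1) ∧ rank r ≤ k ∧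
      ∀ d ∈ r.support, (∀ j ∈ E, d j.castSucc = 0) ∧ ¬ m ≤ d := by
  refine OneLoop.exists_reduction ord I D k _ (fun d hd hB => ?_) f hf
  have hwt {a : Fin 5 →₀ ℕ} (ha : a ≤ d) : wt (d - a) + wt a = wt d := by
    rw [wt, wt, ← map_add, tsub_add_cancel_of_le ha]
  by_cases hm : m ≤ d
  · obtain ⟨q, hq1, hq⟩ := h.exists_quadric_eq
    refine ⟨q, m, hm, hq ▸ h.quadric_ne_zero, hq ▸ h.degree_quadric,
      hq ▸ h.wt_degree.symm ▸ h.rank_quadric_le, fun i _ => ?_⟩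
    have := hwt hm
    have := h.wt_degree
    have := hq1 i
    omega
  · obtain ⟨j, hj, hdj⟩ : ∃ j ∈ E, d j.castSucc ≠ 0 := by
      by_contra! hc
      exact hB ⟨hc, hm⟩
    obtain ⟨b, hb⟩ := h.linear j hj
    have hle : Finsupp.single j.castSucc 1 ≤ d := Finsupp.single_le_iff.2 (by omega)
    have h1 : wt (Finsupp.single j.castSucc 1) = 1 := by
      fin_cases j <;> simp [wt_eq]
    refine ⟨fun i => C (b i), _, hle, hb ▸ h.linear_ne_zero hj, hb ▸ h.degree_linear hj, ?_,
      fun i _ => ?_⟩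
    · rw [← hb, h1]
      exact rank_sub_le (rank_X_castSucc_le j) (h.rank_le j)
    · have := hwt hle
      rw [rank_C]
      omega

end IsQuadricSystem

end

/-! ### The Minkowski product -/

theorem minkowski_add_right (u v w : Momentum) :
    minkowski u (v + w) = minkowski u v + minkowski u w := by
  simp only [minkowski, Pi.add_apply]; ring

theorem minkowski_smul_right (u : Momentum) (a : ℂ) (v : Momentum) :
    minkowski u (a • v) = a * minkowski u v := by
  simp only [minkowski, Pi.smul_apply, smul_eq_mul]; ring

theorem minkowski_comm (u v : Momentum) : minkowski u v = minkowski v u := by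
  simp only [minkowski]; ring

theorem minkowski_zero_right (u : Momentum) : minkowski u 0 = 0 := by
  simp [minkowski]

theorem minkowski_sum_right {ι : Type*} (s : Finset ι) (u : Momentum) (v : ι → Momentum) :
    minkowski u (∑ i ∈ s, v i) = ∑ i ∈ s, minkowski u (v i) := by
  classical
  induction s using Finset.induction_on with
  | empty => simp [minkowski_zero_right]
  | insert a s ha ih => rw [Finset.sum_insert ha, Finset.sum_insert ha, minkowski_add_right, ih]

theorem eq_zero_of_minkowski_eq_zero {u : Momentum} (h : ∀ w, minkowski u w = 0) : u = 0 := by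
  have h0 := h (Pi.single 0 1)
  have h1 := h (Pi.single 1 1)
  have h2 := h (Pi.single 2 1)
  have h3 := h (Pi.single 3 1)
  simp [minkowski] at h0 h1 h2 h3
  funext i
  fin_cases i <;> assumption

theorem linearIndependent_of_gram_det_ne_zero {e : Fin 4 → Momentum}
    (h : (Matrix.of fun i j => minkowski (e i) (e j)).det ≠ 0) : LinearIndependent ℂ e := by
  rw [Fintype.linearIndependent_iff]
  intro a ha
  have : (Matrix.of fun i j => minkowski (e i) (e j)).mulVec a = 0 := by
    funext i
    have := congrArg (minkowski (e i)) ha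
    rw [minkowski_sum_right, minkowski_zero_right] at this
    simpa [Matrix.mulVec, dotProduct, minkowski_smul_right, mul_comm] using this
  exact congrFun (Matrix.eq_zero_of_mulVec_eq_zero h this)

theorem det_cutGram_ne_zero (k : ℕ) : (cutGram k).det ≠ 0 := by
  unfold cutGram
  simp [Matrix.det_succ_row_zero, Fin.sum_univ_succ, Fin.succAbove, Matrix.submatrix]
  split_ifs <;> norm_num

/-- A basis adapted to a cut is a basis. -/
theorem IsCutBasis.linearIndependent' {n : ℕ} {p : Fin n → Momentum} {S : Finset (Fin n)}
    {e : Fin 4 → Momentum} (he : IsCutBasis p S e) : LinearIndependent ℂ e := by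
  by_cases hS : 5 ≤ S.card
  · exact he.linearIndependent hS
  · refine linearIndependent_of_gram_det_ne_zero ?_
    have : (Matrix.of fun i j => minkowski (e i) (e j)) = cutGram S.card := by
      ext i j
      exact he.gram (by omega) i j
    rw [this]
    exact det_cutGram_ne_zero _

theorem exists_sum_smul_eq {e : Fin 4 → Momentum} (he : LinearIndependent ℂ e) (u : Momentum) :
    ∃ a : Fin 4 → ℂ, ∑ j, a j • e j = u := by
  have := he.span_eq_top_of_card_eq_finrank' (by simp)
  exact (Submodule.mem_span_range_iff_exists_fun ℂ).1 (this ▸ Submodule.mem_top (x := u))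

theorem eq_zero_of_minkowski_basis_eq_zero {e : Fin 4 → Momentum} (he : LinearIndependent ℂ e)
    {u : Momentum} (h : ∀ j, minkowski (e j) u = 0) : u = 0 := by
  refine eq_zero_of_minkowski_eq_zero fun w => ?_
  obtain ⟨a, rfl⟩ := exists_sum_smul_eq he w
  rw [minkowski_sum_right]
  refine Finset.sum_eq_zero fun j _ => ?_
  rw [minkowski_smul_right, minkowski_comm, h, mul_zero]

/-! ### Cut variables -/

theorem toCut_X_castSucc (a : Momentum) (e : Fin 4 → Momentum) (ν : Fin 4) :
    toCut a e (X ν.castSucc) = -C (a ν) + ∑ j : Fin 4, C (e j ν) * X j.castSucc := by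
  rw [toCut, aeval_X, Fin.snoc_castSucc]

theorem toCut_X_last (a : Momentum) (e : Fin 4 → Momentum) : toCut a e (X 4) = X 4 := by
  rw [toCut, aeval_X]
  exact Fin.snoc_last (α := fun _ => LoopPoly) _ _

theorem toCut_C (a : Momentum) (e : Fin 4 → Momentum) (z : ℂ) : toCut a e (C z) = C z := by
  rw [toCut, aeval_C, algebraMap_eq]

/-- Expand the square of `(b - a) + ∑ x_j e_j`. The quadratic part does not involve `b`, so
differences of denominators are affine; for `b = a` the affine part disappears. -/
theorem toCut_denominator (a : Momentum) (e : Fin 4 → Momentum) (b : Momentum) (M : ℂ) :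
    toCut a e (denominator b M) =
      ∑ i : Fin 4, ∑ j : Fin 4,
          C (minkowski (e i) (e j)) * (X i.castSucc * X j.castSucc) - C (M ^ 2) - X 4
        + (∑ j : Fin 4, C (2 * minkowski (e j) (b - a)) * X j.castSucc
        + C (minkowski (b - a) (b - a))) := by
  have h (ν : Fin 4) : toCut a e (X ν.castSucc + C (b ν)) =
      C ((b - a) ν) + ∑ j : Fin 4, C (e j ν) * X j.castSucc := by
    rw [map_add, toCut_X_castSucc a e, toCut_C a e, Pi.sub_apply, C_sub]
    ring
  generalize b - a = v at h ⊢
  simp only [denominator, minkowski, map_sub, map_mul]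
  simp only [toCut_X_last a e, toCut_C a e]
  simp only [h]
  simp only [Fin.sum_univ_four, map_ofNat]
  ring

/-! ### Solving for the fixed coordinates by affine independence -/

section

/-- Allows different index types for rows and columns, such as denominators against coordinates; a
trivial left kernel is the form in which affine independence enters. -/
theorem exists_inverse_of_vecMul_eq_zero {m n : Type*} [Fintype m] [Fintype n] [DecidableEq m]
    [DecidableEq n] (A : Matrix m n ℂ) (hmn : Fintype.card m = Fintype.card n)
    (hA : ∀ c, Matrix.vecMul c A = 0 → c = 0) : ∃ B : Matrix n m ℂ, A * B = 1 ∧ B * A = 1 := by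
  let f := Fintype.equivOfCardEq hmn
  let A' : Matrix m m ℂ := A.submatrix id f
  have hA' : IsUnit A' := by
    rw [← Matrix.vecMul_injective_iff_isUnit]
    refine (injective_iff_map_eq_zero (Matrix.vecMulLinear A')).2 fun c hc => hA c ?_
    funext j
    have := congrFun hc (f.symm j)
    simpa [A', Matrix.vecMul, dotProduct] using this
  obtain ⟨B', h1, h2⟩ := isUnit_iff_exists.1 hA'
  refine ⟨B'.submatrix f.symm id, ?_, ?_⟩
  · have : A = A'.submatrix id f.symm := by ext; simp [A']
    rw [this, Matrix.submatrix_mul_equiv, h1, Matrix.submatrix_id_id]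
  · have : A = A'.submatrix id f.symm := by ext; simp [A']
    rw [this, ← Matrix.submatrix_mul _ _ _ id _ Function.bijective_id, h2,
      Matrix.submatrix_one_equiv]

theorem affineIndependent_sum_eq_zero {ι V : Type*} [AddCommGroup V] [Module ℂ V] {S : Finset ι}
    {p : ι → V} (h : AffineIndependent ℂ (fun i : S => p i)) (c : S → ℂ) (h0 : ∑ i, c i = 0)
    (h1 : ∑ i, c i • p i = 0) : c = 0 := by
  funext i
  exact affineIndependent_iff.1 h Finset.univ c h0 h1 i (Finset.mem_univ i)

variable {n : ℕ} {p : Fin n → Momentum} {M : Fin n → ℂ} {S : Finset (Fin n)}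
  {e : Fin 4 → Momentum} {ord : MonomialOrder (Fin 5)}

/-- The Gram matrix of four momenta. -/
def gramMatrix (e : Fin 4 → Momentum) : Matrix (Fin 4) (Fin 4) ℂ :=
  fun i j => minkowski (e i) (e j)

/-- The denominators in the cut variables with origin `p o`. -/
def cutDenominator (p : Fin n → Momentum) (M : Fin n → ℂ) (e : Fin 4 → Momentum) (o i : Fin n) :
    LoopPoly :=
  toCut (p o) e (denominator (p i) (M i))

/-- The constant term of the difference of two denominators. -/
def cutConst (p : Fin n → Momentum) (M : Fin n → ℂ) (o i : Fin n) : ℂ :=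
  minkowski (p i - p o) (p i - p o) - M i ^ 2 + M o ^ 2

theorem cutConst_self (o : Fin n) : cutConst p M o o = 0 := by
  simp [cutConst, minkowski_zero_right]

theorem cutDenominator_origin (o : Fin n) : cutDenominator p M e o o =
    ∑ i : Fin 4, ∑ j : Fin 4, C (gramMatrix e i j) * (X i.castSucc * X j.castSucc)
      - C (M o ^ 2) - X 4 := by
  rw [cutDenominator, toCut_denominator]
  simp [gramMatrix, minkowski_zero_right]

theorem cutDenominator_eq (o i : Fin n) : cutDenominator p M e o i =
    cutDenominator p M e o o + (∑ j : Fin 4, C (2 * minkowski (e j) (p i - p o)) * X j.castSucc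
      + C (cutConst p M o i)) := by
  rw [cutDenominator_origin, cutDenominator, toCut_denominator, cutConst]
  simp only [gramMatrix, C_sub, C_add]
  ring

/-- The affine functions to be eliminated when the coordinates `X j`, `j ∈ E`, are fixed. -/
def fixedCoords (E : Finset (Fin 4)) (x : Fin 4 → ℂ) (j : Fin 4) : LoopPoly :=
  if j ∈ E then C (x j) else X j.castSucc

/-- The coefficients of the differences, with a column of ones added, form a square matrix. Its left
kernel is trivial: the coordinates outside `E` contribute nothing by orthogonality, so nondegeneracy
turns a kernel vector into an affine relation among the momenta. The inverse matrix gives both the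
constants `x` and the combinations of denominators equal to `X j - x j`. The leading exponent is
left to the caller. -/
theorem exists_isQuadricSystem_fixedCoords {o : Fin n} (ho : o ∈ S)
    (hp : AffineIndependent ℂ (fun i : S => p i)) (he : LinearIndependent ℂ e)
    {E : Finset (Fin 4)} (hE : E.card + 1 = S.card)
    (horth : ∀ j ∉ E, ∀ i ∈ S, minkowski (e j) (p i - p o) = 0) :
    ∃ x : Fin 4 → ℂ, ∀ m, wt m = 2 →
      ord.degree (IsQuadricSystem.quadric (gramMatrix e) (M o ^ 2) (fixedCoords E x)) = m →
      IsQuadricSystem ord S (cutDenominator p M e o) E m o (gramMatrix e) (M o ^ 2)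
        (fixedCoords E x) := by
  classical
  let A : Matrix S (Option E) ℂ := fun i j =>
    j.elim 1 fun j => 2 * minkowski (e j) (p i - p o)
  obtain ⟨B, hAB, hBA⟩ := exists_inverse_of_vecMul_eq_zero A (by simp [hE]) (by
    intro c hc
    have h0 : ∑ i, c i = 0 := by
      simpa [A, Matrix.vecMul, dotProduct] using congrFun hc none
    have h1 : ∑ i, c i • (p i - p o) = 0 := by
      refine eq_zero_of_minkowski_basis_eq_zero he fun j => ?_
      rw [minkowski_sum_right]
      simp only [minkowski_smul_right]
      by_cases hj : j ∈ E
      · have := congrFun hc (some ⟨j, hj⟩)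
        simp only [A, Matrix.vecMul, dotProduct, Option.elim, Pi.zero_apply] at this
        have h2 : (2 : ℂ) * ∑ i : S, c i * minkowski (e j) (p i - p o) = 0 := by
          rw [← this, Finset.mul_sum]
          exact Finset.sum_congr rfl fun i _ => by ring
        simpa using h2
      · exact Finset.sum_eq_zero fun i _ => by rw [horth j hj i i.2, mul_zero]
    refine affineIndependent_sum_eq_zero hp c h0 ?_
    simpa only [smul_sub, Finset.sum_sub_distrib, ← Finset.sum_smul, h0, zero_smul, sub_zero]
      using h1)
  let z : Option E → ℂ := B.mulVec fun i => -cutConst p M o i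
  have hz : ∀ i : S, (∑ j : E, 2 * minkowski (e j) (p i - p o) * z (some j)) + z none =
      -cutConst p M o i := by
    intro i
    have : A.mulVec z = fun i : S => -cutConst p M o i := by
      rw [Matrix.mulVec_mulVec, hAB, Matrix.one_mulVec]
    rw [← congrFun this i]
    simp [Matrix.mulVec, dotProduct, A, Fintype.sum_option, add_comm]
  -- In the row of the origin every difference vanishes, so the auxiliary unknown of the column of
  -- ones must be zero.
  have hz0 : z none = 0 := by
    have := hz ⟨o, ho⟩
    simpa [minkowski_zero_right, cutConst_self] using this
  let x : Fin 4 → ℂ := fun j => if hj : j ∈ E then z (some ⟨j, hj⟩) else 0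
  have hx : ∀ i ∈ S, ∑ j, 2 * minkowski (e j) (p i - p o) * x j = -cutConst p M o i := by
    intro i hi
    rw [← hz ⟨i, hi⟩, hz0, add_zero, ← Finset.sum_subset (Finset.subset_univ E),
      ← Finset.sum_coe_sort E]
    · exact Finset.sum_congr rfl fun j _ => by simp [x]
    · intro j _ hj
      simp [x, hj]
  have hy : ∀ j, X j.castSucc - fixedCoords E x j =
      if j ∈ E then (X j.castSucc - C (x j) : LoopPoly) else 0 := by
    intro j
    unfold fixedCoords
    split_ifs <;> simp
  have hdiff : ∀ i ∈ S, cutDenominator p M e o i = cutDenominator p M e o o +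
      ∑ j, C (2 * minkowski (e j) (p i - p o)) * (X j.castSucc - fixedCoords E x j) := by
    intro i hi
    rw [cutDenominator_eq, ← neg_neg (cutConst p M o i), ← hx i hi]
    congr 1
    rw [C_neg, map_sum, ← sub_eq_add_neg, ← Finset.sum_sub_distrib]
    refine Finset.sum_congr rfl fun j _ => ?_
    rw [hy]
    split_ifs with hj
    · simp only [C_mul]
      ring
    · rw [horth j hj i hi]
      simp
  refine ⟨x, fun m hm hdeg => ⟨ho, fun i j => minkowski_comm _ _, cutDenominator_origin o, ?_, ?_,
    ?_, ?_, ?_, fun i hi => ⟨_, hdiff i hi⟩, hdeg, hm⟩⟩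
  · intro j hj
    simp [fixedCoords, hj]
  · intro j
    unfold fixedCoords
    split_ifs
    · simp [rank_C]
    · exact rank_X_castSucc_le j
  · intro j
    by_cases hj : j ∈ E
    · simp [fixedCoords, hj, algebraMap_eq]
    · have : fixedCoords E x j = X j.castSucc := by simp [fixedCoords, hj]
      rw [this, aeval_X, Fin.snoc_castSucc, this]
  · intro j hj
    simp only [fixedCoords, hj, if_true, MonomialOrder.degree_C, map_zero]
    rw [MonomialOrder.toSyn_lt_iff_ne_zero, Ne, MonomialOrder.toSyn_eq_zero_iff]
    simp
  · intro j hj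
    have hB (l : Option E) : ∑ i : S, B (some ⟨j, hj⟩) i * A i l =
        (1 : Matrix (Option E) (Option E) ℂ) (some ⟨j, hj⟩) l := by
      rw [← hBA, Matrix.mul_apply]
    refine ⟨fun i => if hi : i ∈ S then B (some ⟨j, hj⟩) ⟨i, hi⟩ else 0, ?_⟩
    rw [← Finset.sum_coe_sort S]
    simp only [Finset.coe_mem, dite_true, Subtype.coe_eta]
    -- Orthogonality to the column of ones makes the common term `D o` drop out of the combination.
    have h0 : ∑ i : S, B (some ⟨j, hj⟩) i = 0 := by
      simpa [A] using hB none
    have h1 (l : Fin 4) (hl : l ∈ E) : ∑ i : S, B (some ⟨j, hj⟩) i *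
        (2 * minkowski (e l) (p i - p o)) = if l = j then 1 else 0 := by
      rw [show (if l = j then (1 : ℂ) else 0) =
        (1 : Matrix (Option E) (Option E) ℂ) (some ⟨j, hj⟩) (some ⟨l, hl⟩) by
          simp [Matrix.one_apply, eq_comm], ← hB]
      rfl
    calc X j.castSucc - fixedCoords E x j
        = ∑ l, C (if l = j then 1 else 0) * (X l.castSucc - fixedCoords E x l) := by
          simp
      _ = ∑ l, ∑ i : S, C (B (some ⟨j, hj⟩) i) * (C (2 * minkowski (e l) (p i - p o)) *
            (X l.castSucc - fixedCoords E x l)) := by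
          refine Finset.sum_congr rfl fun l _ => ?_
          by_cases hl : l ∈ E
          · rw [← h1 l hl, map_sum, Finset.sum_mul]
            exact Finset.sum_congr rfl fun i _ => by rw [C_mul, mul_assoc]
          · rw [hy, if_neg hl]
            simp
      _ = ∑ i : S, C (B (some ⟨j, hj⟩) i) * cutDenominator p M e o i := by
          rw [Finset.sum_comm]
          have h2 : ∑ i : S, C (B (some ⟨j, hj⟩) i) * cutDenominator p M e o o = 0 := by
            rw [← Finset.sum_mul, ← map_sum, h0, map_zero, zero_mul]
          rw [← zero_add (∑ i : S, ∑ l, _), ← h2, ← Finset.sum_add_distrib]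
          refine Finset.sum_congr rfl fun i _ => ?_
          rw [hdiff i i.2, mul_add, Finset.mul_sum]

end

/-! ### Shape of the reduced polynomials -/

theorem monomial_one_eq (d : Fin 5 →₀ ℕ) : (monomial d 1 : LoopPoly) =
    X 0 ^ d 0 * X 1 ^ d 1 * X 2 ^ d 2 * X 3 ^ d 3 * X 4 ^ d 4 := by
  rw [monomial_eq, Finsupp.prod_fintype _ _ (by simp), Fin.prod_univ_five]
  simp

theorem exists_eq_sum_C_mul {N : ℕ} (v : Fin N → LoopPoly) {r : LoopPoly}
    (h : ∀ d ∈ r.support, ∃ i, v i = monomial d 1) : ∃ c : Fin N → ℂ, r = ∑ i, C (c i) * v i := by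
  have hr : r ∈ Submodule.span ℂ (Set.range v) := by
    rw [r.as_sum]
    refine Submodule.sum_mem _ fun d hd => ?_
    obtain ⟨i, hi⟩ := h d hd
    rw [show (monomial d (coeff d r) : LoopPoly) = coeff d r • v i by
      rw [hi, smul_monomial, smul_eq_mul, mul_one]]
    exact Submodule.smul_mem _ _ (Submodule.subset_span ⟨i, rfl⟩)
  obtain ⟨c, hc⟩ := (Submodule.mem_span_range_iff_exists_fun ℂ).1 hr
  exact ⟨c, by simp only [← hc, smul_eq_C_mul]⟩

/-- The exponent of `x₃ x₄`. -/
abbrev expX3X4 : Fin 5 →₀ ℕ := Finsupp.single 2 1 + Finsupp.single 3 1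

theorem expX3X4_le {d : Fin 5 →₀ ℕ} : expX3X4 ≤ d ↔ 1 ≤ d 2 ∧ 1 ≤ d 3 := by
  rw [Finsupp.le_def]
  simp [Fin.forall_fin_succ]

/-- Reducedness excludes all five variables, so no bound on the rank is needed. -/
theorem shape_five {r : LoopPoly}
    (h : ∀ d ∈ r.support, (∀ j ∈ (Finset.univ : Finset (Fin 4)), d j.castSucc = 0) ∧
      ¬ Finsupp.single 4 1 ≤ d) :
    ∃ c : ℂ, r = C c := by
  obtain ⟨c, hc⟩ := exists_eq_sum_C_mul ![1] (r := r) (by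
    intro d hd
    obtain ⟨h1, h2⟩ := h d hd
    rw [Finsupp.single_le_iff] at h2
    have h3 : d 0 = 0 ∧ d 1 = 0 ∧ d 2 = 0 ∧ d 3 = 0 :=
      ⟨h1 0 (by simp), h1 1 (by simp), h1 2 (by simp), h1 3 (by simp)⟩
    obtain ⟨h30, h31, h32, h33⟩ := h3
    exact ⟨0, by rw [monomial_one_eq, h30, h31, h32, h33, show d 4 = 0 by omega]; simp⟩)
  exact ⟨c 0, by simpa using hc⟩

theorem shape_four {r : LoopPoly} (hr : rank r ≤ 4)
    (h : ∀ d ∈ r.support, (∀ j ∈ ({0, 1, 2} : Finset (Fin 4)), d j.castSucc = 0) ∧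
      ¬ Finsupp.single 3 2 ≤ d) :
    ∃ c : Fin 5 → ℂ, r = C (c 0) + C (c 1) * X 3 + X 4 * (C (c 2) + C (c 3) * X 3
      + X 4 * C (c 4)) := by
  obtain ⟨c, hc⟩ := exists_eq_sum_C_mul ![1, X 3, X 4, X 4 * X 3, X 4 ^ 2] (r := r) (by
    intro d hd
    obtain ⟨h1, h2⟩ := h d hd
    have hw := rank_le_iff.1 hr d hd
    rw [wt_eq] at hw
    rw [Finsupp.single_le_iff] at h2
    have h3 : d 0 = 0 ∧ d 1 = 0 ∧ d 2 = 0 :=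
      ⟨h1 0 (by simp), h1 1 (by simp), h1 2 (by simp)⟩
    obtain ⟨h30, h31, h32⟩ := h3
    rw [monomial_one_eq, h30, h31, h32]
    generalize d 3 = a at *
    generalize d 4 = b at *
    -- These are the solutions of `a ≤ 1` and `a + 2 * b ≤ 4`.
    have : a = 0 ∧ b = 0 ∨ a = 1 ∧ b = 0 ∨ a = 0 ∧ b = 1 ∨ a = 1 ∧ b = 1 ∨ a = 0 ∧ b = 2 := by
      omega
    rcases this with ⟨rfl, rfl⟩ | ⟨rfl, rfl⟩ | ⟨rfl, rfl⟩ | ⟨rfl, rfl⟩ | ⟨rfl, rfl⟩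
    exacts [⟨0, by simp⟩, ⟨1, by simp⟩, ⟨2, by simp⟩, ⟨3, by simp [mul_comm]⟩, ⟨4, by simp⟩])
  refine ⟨c, hc.trans ?_⟩
  simp [Fin.sum_univ_succ]
  ring

theorem shape_three {r : LoopPoly} (hr : rank r ≤ 3)
    (h : ∀ d ∈ r.support, (∀ j ∈ ({0, 1} : Finset (Fin 4)), d j.castSucc = 0) ∧ ¬ expX3X4 ≤ d) :
    ∃ c : Fin 10 → ℂ, r = C (c 0) + C (c 1) * X 2 + C (c 2) * X 2 ^ 2 + C (c 3) * X 2 ^ 3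
      + C (c 4) * X 3 + C (c 5) * X 3 ^ 2 + C (c 6) * X 3 ^ 3
      + X 4 * (C (c 7) + C (c 8) * X 2 + C (c 9) * X 3) := by
  obtain ⟨c, hc⟩ := exists_eq_sum_C_mul
    ![1, X 2, X 2 ^ 2, X 2 ^ 3, X 3, X 3 ^ 2, X 3 ^ 3, X 4, X 2 * X 4, X 3 * X 4] (r := r) (by
    intro d hd
    obtain ⟨h1, h2⟩ := h d hd
    have hw := rank_le_iff.1 hr d hd
    rw [wt_eq] at hw
    rw [expX3X4_le] at h2
    have h3 : d 0 = 0 ∧ d 1 = 0 := ⟨h1 0 (by simp), h1 1 (by simp)⟩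
    obtain ⟨h30, h31⟩ := h3
    rw [monomial_one_eq, h30, h31]
    generalize d 2 = a at *
    generalize d 3 = b at *
    generalize d 4 = s at *
    have : (s = 0 ∧ b = 0 ∧ (a = 0 ∨ a = 1 ∨ a = 2 ∨ a = 3)) ∨
        (s = 0 ∧ a = 0 ∧ (b = 1 ∨ b = 2 ∨ b = 3)) ∨
        (s = 1 ∧ ((a = 0 ∧ b = 0) ∨ (a = 1 ∧ b = 0) ∨ (a = 0 ∧ b = 1))) := by omega
    rcases this with ⟨rfl, rfl, rfl | rfl | rfl | rfl⟩ | ⟨rfl, rfl, rfl | rfl | rfl⟩ |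
      ⟨rfl, ⟨rfl, rfl⟩ | ⟨rfl, rfl⟩ | ⟨rfl, rfl⟩⟩
    exacts [⟨0, by simp⟩, ⟨1, by simp⟩, ⟨2, by simp⟩, ⟨3, by simp⟩, ⟨4, by simp⟩, ⟨5, by simp⟩,
      ⟨6, by simp⟩, ⟨7, by simp⟩, ⟨8, by simp⟩, ⟨9, by simp⟩])
  refine ⟨c, hc.trans ?_⟩
  simp only [Fin.sum_univ_succ]
  simp [Fin.succ]
  ring

theorem shape_two {r : LoopPoly} (hr : rank r ≤ 2)
    (h : ∀ d ∈ r.support, (∀ j ∈ ({0} : Finset (Fin 4)), d j.castSucc = 0) ∧ ¬ expX3X4 ≤ d) :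
    ∃ c : Fin 10 → ℂ, r = C (c 0) + C (c 1) * X 1 + C (c 2) * X 2 + C (c 3) * X 3
      + C (c 4) * X 1 ^ 2 + C (c 5) * X 2 ^ 2 + C (c 6) * X 3 ^ 2
      + C (c 7) * X 1 * X 2 + C (c 8) * X 1 * X 3 + C (c 9) * X 4 := by
  obtain ⟨c, hc⟩ := exists_eq_sum_C_mul
    ![1, X 1, X 2, X 3, X 1 ^ 2, X 2 ^ 2, X 3 ^ 2, X 1 * X 2, X 1 * X 3, X 4] (r := r) (by
    intro d hd
    obtain ⟨h1, h2⟩ := h d hd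
    have hw := rank_le_iff.1 hr d hd
    rw [wt_eq] at hw
    rw [expX3X4_le] at h2
    have h30 : d 0 = 0 := h1 0 (by simp)
    rw [monomial_one_eq, h30]
    generalize d 1 = t at *
    generalize d 2 = a at *
    generalize d 3 = b at *
    generalize d 4 = s at *
    have : (s = 0 ∧ ((t = 0 ∧ a = 0 ∧ b = 0) ∨ (t = 1 ∧ a = 0 ∧ b = 0) ∨ (t = 0 ∧ a = 1 ∧ b = 0) ∨
        (t = 0 ∧ a = 0 ∧ b = 1) ∨ (t = 2 ∧ a = 0 ∧ b = 0) ∨ (t = 0 ∧ a = 2 ∧ b = 0) ∨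
        (t = 0 ∧ a = 0 ∧ b = 2) ∨ (t = 1 ∧ a = 1 ∧ b = 0) ∨ (t = 1 ∧ a = 0 ∧ b = 1))) ∨
        (s = 1 ∧ t = 0 ∧ a = 0 ∧ b = 0) := by omega
    rcases this with ⟨rfl, ⟨rfl, rfl, rfl⟩ | ⟨rfl, rfl, rfl⟩ | ⟨rfl, rfl, rfl⟩ | ⟨rfl, rfl, rfl⟩ |
      ⟨rfl, rfl, rfl⟩ | ⟨rfl, rfl, rfl⟩ | ⟨rfl, rfl, rfl⟩ | ⟨rfl, rfl, rfl⟩ | ⟨rfl, rfl, rfl⟩⟩ |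
      ⟨rfl, rfl, rfl, rfl⟩
    exacts [⟨0, by simp⟩, ⟨1, by simp⟩, ⟨2, by simp⟩, ⟨3, by simp⟩, ⟨4, by simp⟩, ⟨5, by simp⟩,
      ⟨6, by simp⟩, ⟨7, by simp⟩, ⟨8, by simp⟩, ⟨9, by simp⟩])
  refine ⟨c, hc.trans ?_⟩
  simp only [Fin.sum_univ_succ]
  simp [Fin.succ]
  ring

/-- Rank one already excludes `μ²`, which has weight two, so reducedness is not needed. -/
theorem shape_one {r : LoopPoly} (hr : rank r ≤ 1) :
    ∃ β : Fin 5 → ℂ, r = C (β 0) + ∑ j : Fin 4, C (β j.succ) * X j.castSucc := by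
  obtain ⟨c, hc⟩ := exists_eq_sum_C_mul ![1, X 0, X 1, X 2, X 3] (r := r) (by
    intro d hd
    have hw := rank_le_iff.1 hr d hd
    rw [wt_eq] at hw
    rw [monomial_one_eq, show d 4 = 0 by omega]
    generalize d 0 = u at *
    generalize d 1 = t at *
    generalize d 2 = a at *
    generalize d 3 = b at *
    have : (u = 0 ∧ t = 0 ∧ a = 0 ∧ b = 0) ∨ (u = 1 ∧ t = 0 ∧ a = 0 ∧ b = 0) ∨
        (u = 0 ∧ t = 1 ∧ a = 0 ∧ b = 0) ∨ (u = 0 ∧ t = 0 ∧ a = 1 ∧ b = 0) ∨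
        (u = 0 ∧ t = 0 ∧ a = 0 ∧ b = 1) := by omega
    rcases this with ⟨rfl, rfl, rfl, rfl⟩ | ⟨rfl, rfl, rfl, rfl⟩ | ⟨rfl, rfl, rfl, rfl⟩ |
      ⟨rfl, rfl, rfl, rfl⟩ | ⟨rfl, rfl, rfl, rfl⟩
    exacts [⟨0, by simp⟩, ⟨1, by simp⟩, ⟨2, by simp⟩, ⟨3, by simp⟩, ⟨4, by simp⟩])
  refine ⟨c, hc.trans ?_⟩
  rw [Fin.sum_univ_succ]
  simp [Fin.sum_univ_four]

/-! ### The quadric systems of cuts with one to five denominators -/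

section

variable {n : ℕ} {p : Fin n → Momentum} {M : Fin n → ℂ} {S : Finset (Fin n)}
  {e : Fin 4 → Momentum} {ord : MonomialOrder (Fin 5)}

theorem C_two : (C 2 : LoopPoly) = 2 := map_ofNat C 2

theorem monomial_mul_X (i j : Fin 5) (a : ℂ) :
    (monomial (Finsupp.single i 1 + Finsupp.single j 1) a : LoopPoly) = C a * (X i * X j) := by
  rw [X, X, monomial_mul, C_mul_monomial, one_mul, mul_one]

theorem degree_monomial_add_of_lt {m : Fin 5 →₀ ℕ} {a : ℂ} (ha : a ≠ 0) {t : LoopPoly}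
    (ht : ord.degree t ≺[ord] m) : ord.degree (monomial m a + t) = m := by
  classical
  have hm : ord.degree (monomial m a : LoopPoly) = m := by
    rw [MonomialOrder.degree_monomial, if_neg ha]
  rw [MonomialOrder.degree_add_of_lt (by rwa [hm]), hm]

theorem degree_add_lt {m : Fin 5 →₀ ℕ} {f g : LoopPoly} (hf : ord.degree f ≺[ord] m)
    (hg : ord.degree g ≺[ord] m) : ord.degree (f + g) ≺[ord] m :=
  MonomialOrder.degree_add_le.trans_lt (max_lt hf hg)

theorem degree_monomial_lt {m d : Fin 5 →₀ ℕ} (h : d ≺[ord] m) (a : ℂ) :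
    ord.degree (monomial d a : LoopPoly) ≺[ord] m :=
  (MonomialOrder.degree_monomial_le a).trans_lt h

theorem zero_lt_toSyn {m : Fin 5 →₀ ℕ} (h : m ≠ 0) : (0 : Fin 5 →₀ ℕ) ≺[ord] m := by
  rw [map_zero, MonomialOrder.toSyn_lt_iff_ne_zero, Ne, MonomialOrder.toSyn_eq_zero_iff]
  exact h

theorem gramMatrix_eq (he : IsCutBasis p S e) (hS : S.card < 5) :
    gramMatrix e = cutGram S.card := by
  ext i j
  exact he.gram hS i j

/-- All four coordinates become constants, so the quadric is a constant minus `μ²` and leads with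
`μ²` in every monomial order. -/
theorem exists_isQuadricSystem_five {o : Fin n} (ho : o ∈ S) (hgen : GenericKinematics p M)
    (he : IsCutBasis p S e) (hS : S.card = 5) :
    ∃ A c y, IsQuadricSystem ord S (cutDenominator p M e o) Finset.univ (Finsupp.single 4 1)
      o A c y := by
  obtain ⟨x, hx⟩ := exists_isQuadricSystem_fixedCoords (ord := ord) (M := M) ho
    (hgen.momenta S hS.le) he.linearIndependent' (E := Finset.univ) (by simp [hS]) (by simp)
  refine ⟨_, _, _, hx _ (by simp [wt_eq]) ?_⟩
  have : IsQuadricSystem.quadric (gramMatrix e) (M o ^ 2) (fixedCoords Finset.univ x) =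
      monomial (Finsupp.single 4 1) (-1) + monomial 0
        (∑ i : Fin 4, ∑ j : Fin 4, gramMatrix e i j * (x i * x j) - M o ^ 2) := by
    simp only [IsQuadricSystem.quadric, fixedCoords, Finset.mem_univ, if_true, monomial_zero',
      map_sub, map_sum, map_mul, map_neg]
    simp only [X]
    ring
  rw [this]
  exact degree_monomial_add_of_lt (by simp)
    (degree_monomial_lt (zero_lt_toSyn (by simp)) _)

/-- Only `x₄` stays free; as `e₄² = 1` and `e₄` is orthogonal to the other basis vectors, the
quadric is `x₄² - μ²` plus a constant. -/
theorem exists_isQuadricSystem_four (hord : IsCutOrder ord) {o : Fin n} (ho : o ∈ S)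
    (hgen : GenericKinematics p M) (he : IsCutBasis p S e) (hS : S.card = 4) :
    ∃ A c y, IsQuadricSystem ord S (cutDenominator p M e o) {0, 1, 2} (Finsupp.single 3 2)
      o A c y := by
  obtain ⟨x, hx⟩ := exists_isQuadricSystem_fixedCoords (ord := ord) (M := M) ho
    (hgen.momenta S (by omega)) he.linearIndependent' (E := {0, 1, 2}) (by simp [hS]) (by
      intro j hj i hi
      fin_cases j <;> simp at hj
      exact he.orthogonal_four (by omega) i hi o ho)
  refine ⟨_, _, _, hx _ (by simp [wt_eq]) ?_⟩
  have : IsQuadricSystem.quadric (gramMatrix e) (M o ^ 2) (fixedCoords {0, 1, 2} x) =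
      monomial (Finsupp.single 3 2) 1 + (monomial (Finsupp.single 4 1) (-1) + monomial 0
        (2 * (x 0 * x 1) + x 2 ^ 2 - M o ^ 2)) := by
    rw [gramMatrix_eq he (by omega), hS, ← X_pow_eq_monomial, ← C_mul_X_eq_monomial]
    simp [IsQuadricSystem.quadric, fixedCoords, cutGram, Fin.sum_univ_four, C_two]
    ring
  rw [this]
  exact degree_monomial_add_of_lt (by simp) (degree_add_lt (degree_monomial_lt hord.mu_lt_x4_sq _)
    (degree_monomial_lt (zero_lt_toSyn (by simp)) _))

theorem expX3X4_ne_zero : expX3X4 ≠ 0 := by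
  intro h
  simpa using DFunLike.congr_fun h 2

/-- With `e₃² = e₄² = 0` and `e₃ · e₄ = -1`, the quadric is `-2 x₃ x₄ - μ²` plus a constant. -/
theorem exists_isQuadricSystem_three (hord : IsCutOrder ord) {o : Fin n} (ho : o ∈ S)
    (hgen : GenericKinematics p M) (he : IsCutBasis p S e) (hS : S.card = 3) :
    ∃ A c y, IsQuadricSystem ord S (cutDenominator p M e o) {0, 1} expX3X4 o A c y := by
  obtain ⟨x, hx⟩ := exists_isQuadricSystem_fixedCoords (ord := ord) (M := M) ho
    (hgen.momenta S (by omega)) he.linearIndependent' (E := {0, 1}) (by simp [hS]) (by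
      intro j hj i hi
      fin_cases j <;> simp at hj
      · exact he.orthogonal_three (by omega) i hi o ho
      · exact he.orthogonal_four (by omega) i hi o ho)
  refine ⟨_, _, _, hx _ (by simp [wt_eq]) ?_⟩
  have : IsQuadricSystem.quadric (gramMatrix e) (M o ^ 2) (fixedCoords {0, 1} x) =
      monomial expX3X4 (-2) + (monomial (Finsupp.single 4 1) (-1) + monomial 0
        (2 * (x 0 * x 1) - M o ^ 2)) := by
    rw [gramMatrix_eq he (by omega), hS, expX3X4, monomial_mul_X, ← C_mul_X_eq_monomial]
    simp [IsQuadricSystem.quadric, fixedCoords, cutGram, Fin.sum_univ_four, C_two]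
    ring
  rw [this]
  exact degree_monomial_add_of_lt (by simp) (degree_add_lt (degree_monomial_lt hord.mu_lt_x3x4 _)
    (degree_monomial_lt (zero_lt_toSyn expX3X4_ne_zero) _))

theorem single_one_lt_expX3X4 (hord : IsCutOrder ord) :
    (Finsupp.single 1 1 : Fin 5 →₀ ℕ) ≺[ord] expX3X4 := by
  refine lt_of_le_of_lt (ord.toSyn_monotone ?_) hord.x2_sq_lt_x3x4
  rw [Finsupp.single_le_iff]
  simp

/-- The single difference involves only `x₁` and `x₂`, and `x₁` has a nonzero coefficient. Solving
for `x₁` requires `x₂ ≺ x₁`; the term `2 x₁ x₂` then turns into terms in `x₂²` and `x₂`, which must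
lie below `x₃ x₄`. -/
theorem exists_isQuadricSystem_two (hord : IsCutOrder ord) {o : Fin n} (ho : o ∈ S)
    (he : IsCutBasis p S e) (hS : S.card = 2) :
    ∃ A c y, IsQuadricSystem ord S (cutDenominator p M e o) {0} expX3X4 o A c y := by
  classical
  obtain ⟨i, hi⟩ : ∃ i, S.erase o = {i} :=
    Finset.card_eq_one.1 (by rw [Finset.card_erase_of_mem ho, hS])
  have hio : i ≠ o ∧ i ∈ S := by
    rw [← Finset.mem_erase, hi]
    simp
  have hSi : S = {o, i} := by rw [← Finset.insert_erase ho, hi]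
  let b : Fin 4 → ℂ := fun j => 2 * minkowski (e j) (p i - p o)
  have hb0 : b 0 ≠ 0 := mul_ne_zero two_ne_zero (he.not_parallel hS i hio.2 o ho hio.1)
  have hb2 : b 2 = 0 := by
    simp only [b, he.orthogonal_three (by omega) i hio.2 o ho, mul_zero]
  have hb3 : b 3 = 0 := by
    simp only [b, he.orthogonal_four (by omega) i hio.2 o ho, mul_zero]
  -- `x₁ = α x₂ + β` is the solution of `D i = D o`.
  let α : ℂ := -b 1 / b 0
  let β : ℂ := -cutConst p M o i / b 0
  let y : Fin 4 → LoopPoly := ![C α * X 1 + C β, X 1, X 2, X 3]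
  have hDi : cutDenominator p M e o i = cutDenominator p M e o o + C (b 0) * (X 0 - y 0) := by
    rw [cutDenominator_eq o i]
    have h1 : b 0 * α = -b 1 := mul_div_cancel₀ _ hb0
    have h2 : b 0 * β = -cutConst p M o i := mul_div_cancel₀ _ hb0
    have h3 : C (b 0) * (X 0 - y 0) = C (b 0) * X 0 - C (b 0 * α) * X 1 - C (b 0 * β) := by
      simp only [y, Matrix.cons_val_zero, C_mul]
      ring
    have h4 : ∑ j : Fin 4, C (2 * minkowski (e j) (p i - p o)) * (X j.castSucc : LoopPoly) =
        C (b 0) * X 0 + C (b 1) * X 1 + C (b 2) * X 2 + C (b 3) * X 3 := by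
      rw [Fin.sum_univ_four]
      rfl
    rw [h4, h3, h1, h2, hb2, hb3]
    simp only [C_neg, C_0]
    ring
  have hlt1 : (Finsupp.single 1 1 : Fin 5 →₀ ℕ) ≺[ord] Finsupp.single 0 1 := hord.x2_lt_x1
  refine ⟨gramMatrix e, M o ^ 2, y, ho, fun i j => minkowski_comm _ _, cutDenominator_origin o,
    ?_, ?_, ?_, ?_, ?_, ?_, ?_, by simp [wt_eq]⟩
  · intro j hj
    fin_cases j <;> simp [y] at hj ⊢
  · intro j
    fin_cases j
    · exact rank_add_le (rank_C_mul_le _ (rank_X_castSucc_le 1)) (by simp [rank_C])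
    · exact rank_X_castSucc_le 1
    · exact rank_X_castSucc_le 2
    · exact rank_X_castSucc_le 3
  · intro j
    have h (j : Fin 4) := IsQuadricSystem.eliminate_X_castSucc y j
    change IsQuadricSystem.eliminate y (y j) = y j
    have h1 : IsQuadricSystem.eliminate y (X 1) = X 1 := h 1
    fin_cases j
    · change IsQuadricSystem.eliminate y (C α * X 1 + C β) = C α * X 1 + C β
      rw [map_add, map_mul, IsQuadricSystem.eliminate_C, IsQuadricSystem.eliminate_C, h1]
    · exact h1
    · exact h 2
    · exact h 3
  · intro j hj
    obtain rfl := Finset.mem_singleton.1 hj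
    change ord.degree (C α * X 1 + C β) ≺[ord] Finsupp.single 0 1
    rw [C_mul_X_eq_monomial]
    refine degree_add_lt (degree_monomial_lt hlt1 _) ?_
    rw [MonomialOrder.degree_C]
    exact zero_lt_toSyn (by simp)
  · intro j hj
    obtain rfl := Finset.mem_singleton.1 hj
    refine ⟨fun l => if l = i then (b 0)⁻¹ else -(b 0)⁻¹, ?_⟩
    have : (C (b 0)⁻¹ * C (b 0) : LoopPoly) = 1 := by
      rw [← C_mul, inv_mul_cancel₀ hb0, C_1]
    rw [hSi, Finset.sum_pair hio.1.symm]
    simp only [if_neg hio.1.symm, if_true]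
    rw [hDi, C_neg, mul_add,
      ← mul_assoc, this, Fin.castSucc_zero]
    ring
  · intro l hl
    rw [hSi] at hl
    rcases Finset.mem_insert.1 hl with rfl | hl
    · exact ⟨0, by simp⟩
    · obtain rfl := Finset.mem_singleton.1 hl
      exact ⟨Pi.single 0 (b 0), by rw [hDi]; simp [Fin.sum_univ_four]⟩
  · have : IsQuadricSystem.quadric (gramMatrix e) (M o ^ 2) y = monomial expX3X4 (-2) +
        (monomial (Finsupp.single 4 1) (-1) + (monomial (Finsupp.single 1 2) (2 * α) +
        (monomial (Finsupp.single 1 1) (2 * β) + monomial 0 (- M o ^ 2)))) := by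
      rw [gramMatrix_eq he (by omega), hS, expX3X4, monomial_mul_X, ← C_mul_X_eq_monomial,
        ← C_mul_X_eq_monomial, ← C_mul_X_pow_eq_monomial]
      simp [IsQuadricSystem.quadric, y, cutGram, Fin.sum_univ_four, C_two]
      ring
    change ord.degree (IsQuadricSystem.quadric (gramMatrix e) (M o ^ 2) y) = _
    rw [this]
    exact degree_monomial_add_of_lt (by simp) (degree_add_lt
      (degree_monomial_lt hord.mu_lt_x3x4 _) (degree_add_lt
      (degree_monomial_lt hord.x2_sq_lt_x3x4 _) (degree_add_lt
      (degree_monomial_lt (single_one_lt_expX3X4 hord) _)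
      (degree_monomial_lt (zero_lt_toSyn expX3X4_ne_zero) _))))

/-- Which monomial leads is immaterial: the nonconstant monomials of the denominator all have weight
two, and the presence of `x₃ x₄` prevents the constant from leading. -/
theorem exists_isQuadricSystem_one {o : Fin n} (ho : o ∈ S)
    (he : IsCutBasis p S e) (hS : S.card = 1) :
    ∃ m A c y, IsQuadricSystem ord S (cutDenominator p M e o) ∅ m o A c y := by
  classical
  have hSo : S = {o} := by
    obtain ⟨i, rfl⟩ := Finset.card_eq_one.1 hS
    rw [Finset.mem_singleton.1 ho]
  let y : Fin 4 → LoopPoly := fun j => X j.castSucc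
  refine ⟨_, gramMatrix e, M o ^ 2, y, ho, fun i j => minkowski_comm _ _, cutDenominator_origin o,
    by simp [y], rank_X_castSucc_le, fun j => ?_, by simp, by simp, fun i hi => ⟨0, ?_⟩, rfl, ?_⟩
  · rw [aeval_X, Fin.snoc_castSucc]
  · rw [hSo] at hi
    rw [Finset.mem_singleton.1 hi]
    simp
  · change wt (ord.degree (IsQuadricSystem.quadric (gramMatrix e) (M o ^ 2) y)) = 2
    have hq : IsQuadricSystem.quadric (gramMatrix e) (M o ^ 2) y = monomial expX3X4 (-2) +
        (monomial (Finsupp.single 0 1 + Finsupp.single 1 1) 2 +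
        (monomial (Finsupp.single 4 1) (-1) + monomial 0 (- M o ^ 2))) := by
      rw [gramMatrix_eq he (by omega), hS, expX3X4, monomial_mul_X, monomial_mul_X,
        ← C_mul_X_eq_monomial]
      simp [IsQuadricSystem.quadric, y, cutGram, Fin.sum_univ_four, C_two]
      ring
    generalize (-M o ^ 2) = c at hq
    have hne : (Finsupp.single 0 1 + Finsupp.single 1 1 : Fin 5 →₀ ℕ) ≠ expX3X4 := by
      intro h
      simpa using DFunLike.congr_fun h 2
    have hne' : (Finsupp.single 4 1 : Fin 5 →₀ ℕ) ≠ expX3X4 := by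
      intro h
      simpa using DFunLike.congr_fun h 2
    have hmem : expX3X4 ∈ (IsQuadricSystem.quadric (gramMatrix e) (M o ^ 2) y).support := by
      rw [mem_support_iff, hq]
      simp [coeff_monomial, hne, hne', expX3X4_ne_zero.symm]
    have h0 : ord.degree (IsQuadricSystem.quadric (gramMatrix e) (M o ^ 2) y) ≠ 0 := by
      intro h
      have := ord.le_degree hmem
      rw [h] at this
      exact absurd this (not_le.2 (zero_lt_toSyn expX3X4_ne_zero))
    have hdeg := (ord.degree_mem_support_iff _).2 (ord.ne_zero_of_degree_ne_zero h0)
    generalize ord.degree (IsQuadricSystem.quadric (gramMatrix e) (M o ^ 2) y) = d at h0 hdeg ⊢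
    by_contra hd
    have h1 : expX3X4 ≠ d := by rintro rfl; simp [wt_eq] at hd
    have h2 : Finsupp.single 0 1 + Finsupp.single 1 1 ≠ d := by rintro rfl; simp [wt_eq] at hd
    have h3 : Finsupp.single 4 1 ≠ d := by rintro rfl; simp [wt_eq] at hd
    rw [mem_support_iff, hq] at hdeg
    simp [coeff_monomial, h1, h2, h3, h0.symm] at hdeg

end

/-! ### The change to cut variables and its inverse -/

section

variable {n : ℕ} {p : Fin n → Momentum} {M : Fin n → ℂ} {S : Finset (Fin n)}
  {e : Fin 4 → Momentum} {ord : MonomialOrder (Fin 5)}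

theorem rank_toCut_le (a : Momentum) (e : Fin 4 → Momentum) (f : LoopPoly) :
    rank (toCut a e f) ≤ rank f := by
  refine rank_aeval_le (fun i => ?_) f
  induction i using Fin.lastCases with
  | last =>
    rw [Fin.snoc_last]
    exact rank_X_last_le
  | cast j =>
    rw [Fin.snoc_castSucc]
    refine (rank_add_le (k := 1) ?_ (rank_sum_le _ fun i _ =>
      rank_C_mul_le _ (rank_X_castSucc_le i))).trans ?_
    · rw [rank_neg, rank_C]
      exact zero_le_one
    · fin_cases j <;> simp

/-- The passage to the cut variables is an isomorphism that preserves bounds on the rank. -/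
theorem exists_inverse_toCut (a : Momentum) (he : LinearIndependent ℂ e) :
    ∃ ψ : LoopPoly →ₐ[ℂ] LoopPoly, (∀ f, ψ (toCut a e f) = f) ∧ (∀ f, toCut a e (ψ f) = f) ∧
      ∀ f, rank (ψ f) ≤ rank f := by
  let A : Matrix (Fin 4) (Fin 4) ℂ := fun j ν => e j ν
  obtain ⟨B, hAB, hBA⟩ := exists_inverse_of_vecMul_eq_zero A rfl (by
    intro c hc
    refine funext (Fintype.linearIndependent_iff.1 he c ?_)
    funext ν
    simpa [A, Matrix.vecMul, dotProduct] using congrFun hc ν)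
  -- The inverse substitution: the coordinates of `q + a` in the basis `e`.
  let y : Fin 4 → LoopPoly := fun j => ∑ ν : Fin 4, C (B ν j) * (X ν.castSucc + C (a ν))
  let ψ : LoopPoly →ₐ[ℂ] LoopPoly := aeval (Fin.snoc (α := fun _ => LoopPoly) y (X 4))
  have hψX (j : Fin 4) : ψ (X j.castSucc) = y j := by
    simp only [ψ]
    rw [aeval_X, Fin.snoc_castSucc]
  have hψ4 : ψ (X 4) = X 4 := by
    simp only [ψ]
    rw [aeval_X]
    exact Fin.snoc_last (α := fun _ => LoopPoly) _ _
  have hψC (z : ℂ) : ψ (C z) = C z := by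
    simp only [ψ]
    rw [aeval_C, algebraMap_eq]
  have h1 : ψ.comp (toCut a e) = AlgHom.id ℂ LoopPoly := by
    refine algHom_ext fun i => ?_
    induction i using Fin.lastCases with
    | last => exact (congrArg ψ (toCut_X_last a e)).trans hψ4
    | cast ν =>
      rw [AlgHom.comp_apply, toCut_X_castSucc, map_add, map_neg, hψC, map_sum, AlgHom.id_apply]
      have : ∑ j : Fin 4, ψ (C (e j ν) * X j.castSucc) = X ν.castSucc + C (a ν) := by
        calc ∑ j : Fin 4, ψ (C (e j ν) * X j.castSucc)
            = ∑ j : Fin 4, ∑ l : Fin 4, C (B l j * A j ν) * (X l.castSucc + C (a l)) := by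
              refine Finset.sum_congr rfl fun j _ => ?_
              rw [map_mul, hψC, hψX, Finset.mul_sum]
              refine Finset.sum_congr rfl fun l _ => ?_
              rw [C_mul]
              ring
          _ = ∑ l : Fin 4, C ((1 : Matrix (Fin 4) (Fin 4) ℂ) l ν) *
                (X l.castSucc + C (a l)) := by
              rw [Finset.sum_comm]
              refine Finset.sum_congr rfl fun l _ => ?_
              rw [← hBA, Matrix.mul_apply, map_sum, Finset.sum_mul]
          _ = X ν.castSucc + C (a ν) := by
              rw [Finset.sum_eq_single ν] <;> simp +contextual
      rw [this]
      ring
  have h2 : (toCut a e).comp ψ = AlgHom.id ℂ LoopPoly := by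
    refine algHom_ext fun i => ?_
    induction i using Fin.lastCases with
    | last => exact (congrArg (toCut a e) hψ4).trans (toCut_X_last a e)
    | cast j =>
      rw [AlgHom.comp_apply, hψX, AlgHom.id_apply]
      have hX (ν : Fin 4) : toCut a e (X ν.castSucc + C (a ν)) =
          ∑ l : Fin 4, C (A l ν) * X l.castSucc := by
        rw [map_add, toCut_X_castSucc, toCut_C]
        simp only [A]
        ring
      calc toCut a e (y j)
          = ∑ ν : Fin 4, ∑ l : Fin 4, C (A l ν * B ν j) * X l.castSucc := by
            rw [map_sum]
            refine Finset.sum_congr rfl fun ν _ => ?_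
            rw [map_mul, toCut_C, hX, Finset.mul_sum]
            refine Finset.sum_congr rfl fun l _ => ?_
            rw [C_mul]
            ring
        _ = ∑ l : Fin 4, C ((1 : Matrix (Fin 4) (Fin 4) ℂ) l j) * X l.castSucc := by
            rw [Finset.sum_comm]
            refine Finset.sum_congr rfl fun l _ => ?_
            rw [← hAB, Matrix.mul_apply, map_sum, Finset.sum_mul]
        _ = X j.castSucc := by
            rw [Finset.sum_eq_single j] <;> simp +contextual
  refine ⟨ψ, fun f => DFunLike.congr_fun h1 f, fun f => DFunLike.congr_fun h2 f, fun f => ?_⟩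
  refine rank_aeval_le (fun i => ?_) f
  induction i using Fin.lastCases with
  | last =>
    rw [Fin.snoc_last]
    exact rank_X_last_le
  | cast j =>
    rw [Fin.snoc_castSucc]
    refine (rank_sum_le (k := 1) _ fun i _ => rank_C_mul_le _ (rank_add_le (rank_X_castSucc_le i)
      (by simp [rank_C]))).trans ?_
    fin_cases j <;> simp

theorem toCut_injective (a : Momentum) (he : LinearIndependent ℂ e) :
    Function.Injective (toCut a e) := by
  obtain ⟨ψ, h, -⟩ := exists_inverse_toCut a he
  exact Function.LeftInverse.injective h

/-! ### Cuts with at least six denominators -/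

/-- Separates the part common to all denominators from the part linear in the lifted point `(q, q² -
z²)`, so that linear algebra on the lifted points controls the constant combinations. -/
theorem denominator_eq (q : Momentum) (z : ℂ) : denominator q z =
    (X 0 * X 0 - X 1 * X 1 - X 2 * X 2 - X 3 * X 3 - X 4) +
      (C (q 0) * (2 * X 0) - C (q 1) * (2 * X 1) - C (q 2) * (2 * X 2) - C (q 3) * (2 * X 3)) +
      C (minkowski q q - z ^ 2) := by
  simp only [denominator, minkowski, map_sub, map_mul]
  simp only [Fin.castSucc_zero, Fin.castSucc_one, show (2 : Fin 4).castSucc = 2 from rfl,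
    show (3 : Fin 4).castSucc = 3 from rfl]
  ring

/-- Six denominators in general position generate the affine functions and `μ²`. -/
theorem exists_six_combinations (hgen : GenericKinematics p M) (hS : 6 ≤ S.card) :
    (∃ h : Fin n → ℂ, ∑ i ∈ S, C (h i) * denominator (p i) (M i) = 1) ∧
    (∀ ν : Fin 4, ∃ h : Fin n → ℂ, ∑ i ∈ S, C (h i) * denominator (p i) (M i) = X ν.castSucc) ∧
    ∃ h : Fin n → LoopPoly, (∀ i, rank (h i) ≤ 1) ∧
      ∑ i ∈ S, h i * denominator (p i) (M i) = X 4 := by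
  classical
  obtain ⟨T, hTS, hT⟩ := Finset.exists_subset_card_eq hS
  -- A row is `1`, the lifted coordinate `p² - M²` and the four components of `p`: six columns for
  -- six denominators.
  let A : Matrix T (Option (Option (Fin 4))) ℂ := fun i l =>
    l.elim 1 fun l => l.elim (minkowski (p i) (p i) - M i ^ 2) fun ν => p i ν
  obtain ⟨B, -, hBA⟩ := exists_inverse_of_vecMul_eq_zero A (by simp [hT]) (by
    intro c hc
    refine affineIndependent_sum_eq_zero
      (p := fun i => ((p i, minkowski (p i) (p i) - M i ^ 2) : Momentum × ℂ))
      (hgen.lifted T hT.le) c ?_ ?_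
    · simpa [A, Matrix.vecMul, dotProduct] using congrFun hc none
    · refine Prod.ext ?_ ?_
      · funext ν
        simpa [A, Matrix.vecMul, dotProduct, Prod.fst_sum] using congrFun hc (some (some ν))
      · simpa [A, Matrix.vecMul, dotProduct, Prod.snd_sum] using congrFun hc (some none))
  let P : LoopPoly := X 0 * X 0 - X 1 * X 1 - X 2 * X 2 - X 3 * X 3 - X 4
  let b : Option (Option (Fin 4)) → Fin n → ℂ := fun l i => if hi : i ∈ T then B l ⟨i, hi⟩ else 0
  let δ : Matrix (Option (Option (Fin 4))) (Option (Option (Fin 4))) ℂ := 1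
  have hB (l l') : ∑ i, B l i * A i l' = δ l l' := by
    simp only [δ, ← hBA, Matrix.mul_apply]
  -- A row of the inverse matrix selects one term: `P`, the constant `1`, or `2 X ν` up to the sign
  -- of the metric.
  have hb (l) : ∑ i ∈ S, C (b l i) * denominator (p i) (M i) =
      C (δ l none) * P +
      (C (δ l (some (some (0 : Fin 4)))) * (2 * X 0)
        - C (δ l (some (some (1 : Fin 4)))) * (2 * X 1)
        - C (δ l (some (some (2 : Fin 4)))) * (2 * X 2)
        - C (δ l (some (some (3 : Fin 4)))) * (2 * X 3)) +
      C (δ l (some none)) := by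
    rw [← Finset.sum_subset hTS (fun i _ hi => by simp [b, hi]), ← Finset.sum_coe_sort T]
    simp only [← hB, map_sum, Finset.sum_mul, ← Finset.sum_add_distrib, ← Finset.sum_sub_distrib]
    refine Finset.sum_congr rfl fun i _ => ?_
    simp only [b, Finset.coe_mem, dite_true, Subtype.coe_eta, denominator_eq, A, Option.elim,
      C_mul, P, C_1]
    ring
  have hX (ν : Fin 4) : ∃ h : Fin n → ℂ,
      ∑ i ∈ S, C (h i) * denominator (p i) (M i) = X ν.castSucc := by
    have hscale : ∀ a : ℂ, C (a / 2) * (2 : LoopPoly) = C a := by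
      intro a
      rw [← C_two, ← C_mul, div_mul_cancel₀ _ two_ne_zero]
    obtain ⟨s, hs⟩ : ∃ s : ℂ, ∑ i ∈ S, C (s * b (some (some ν)) i) * denominator (p i) (M i) =
        X ν.castSucc := by
      simp only [C_mul, mul_assoc]
      simp only [← Finset.mul_sum, hb]
      fin_cases ν
      · refine ⟨1 / 2, ?_⟩
        simp only [← mul_assoc]
        simp [δ, ← mul_assoc]
        rw [← C_two, ← C_mul, inv_mul_cancel₀ two_ne_zero, C_1]
      all_goals
        refine ⟨-1 / 2, ?_⟩
        simp [δ, ← mul_assoc, hscale]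
    exact ⟨_, hs⟩
  refine ⟨⟨b (some none), ?_⟩, hX, ?_⟩
  · rw [hb]
    simp [δ]
  · choose h hh using hX
    have hP : ∑ i ∈ S, C (b none i) * denominator (p i) (M i) = P := by
      rw [hb]
      simp [δ]
    -- Here `μ² = X 0 * X 0 - X 1 * X 1 - X 2 * X 2 - X 3 * X 3 - P`, where one factor of each
    -- square is replaced by its combination of denominators.
    refine ⟨fun i => X 0 * C (h 0 i) - X 1 * C (h 1 i) - X 2 * C (h 2 i) - X 3 * C (h 3 i)
      - C (b none i), fun i => ?_, ?_⟩
    · have hr (ν : Fin 4) (z : ℂ) : rank (X ν.castSucc * C z) ≤ 1 := by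
        rw [mul_comm]
        exact rank_C_mul_le _ (rank_X_castSucc_le ν)
      exact rank_sub_le (rank_sub_le (rank_sub_le (rank_sub_le (hr 0 _) (hr 1 _)) (hr 2 _))
        (hr 3 _)) (by simp [rank_C])
    · simp only [sub_mul, Finset.sum_sub_distrib, mul_assoc]
      rw [hP, ← Finset.mul_sum, ← Finset.mul_sum, ← Finset.mul_sum, ← Finset.mul_sum,
        hh, hh, hh, hh]
      simp only [P, Fin.castSucc_zero, Fin.castSucc_one, show (2 : Fin 4).castSucc = 2 from rfl,
        show (3 : Fin 4).castSucc = 3 from rfl]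
      ring

/-- Multiplying `f` by the combination equal to `1` would only bound the quotients by the rank of
`f`. Dividing nonconstant monomials by a variable instead saves the needed unit; only constants use
`1`. No exponent is allowed in the remainder, which is therefore zero. -/
theorem exists_eq_sum_of_six_le (ord : MonomialOrder (Fin 5)) (hgen : GenericKinematics p M)
    (hS : 6 ≤ S.card) {f : LoopPoly} (hf : rank f ≤ S.card) :
    ∃ Q : Fin n → LoopPoly, f = ∑ i ∈ S, Q i * denominator (p i) (M i) ∧
      ∀ i ∈ S, rank (Q i) ≤ S.card - 1 := by
  obtain ⟨⟨h1, hh1⟩, hX, h4, hr4, hh4⟩ := exists_six_combinations hgen hS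
  obtain ⟨Q, r, hQ, hQr, -, hr⟩ := exists_reduction ord S (fun i => denominator (p i) (M i)) S.card
    (fun _ => False) (fun d hd _ => by
      have hwt {a : Fin 5 →₀ ℕ} (ha : a ≤ d) : wt (d - a) + wt a = wt d := by
        rw [wt, wt, ← map_add, tsub_add_cancel_of_le ha]
      by_cases hd0 : d = 0
      · refine ⟨fun i => C (h1 i), 0, by simp, ?_⟩
        rw [hh1]
        refine ⟨one_ne_zero, by simp, by simpa using (rank_C 1).le, fun i _ => ?_⟩
        rw [rank_C, hd0]
        simp
      · obtain ⟨l, hl⟩ : ∃ l, d l ≠ 0 := by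
          by_contra! hc
          exact hd0 (Finsupp.ext hc)
        have hle : Finsupp.single l 1 ≤ d := Finsupp.single_le_iff.2 (by omega)
        have := hwt hle
        induction l using Fin.lastCases with
        | last =>
          have h2 : wt (Finsupp.single (Fin.last 4) 1) = 2 := by
            rw [show Fin.last 4 = 4 from rfl]
            simp [wt_eq]
          refine ⟨h4, _, hle, ?_⟩
          rw [hh4]
          refine ⟨X_ne_zero _, MonomialOrder.degree_X, rank_X_last_le.trans h2.ge, fun i _ => ?_⟩
          have := hr4 i
          omega
        | cast ν =>
          have h2 : wt (Finsupp.single ν.castSucc 1) = 1 := by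
            fin_cases ν <;> simp [wt_eq]
          obtain ⟨h, hh⟩ := hX ν
          refine ⟨fun i => C (h i), _, hle, ?_⟩
          rw [hh]
          refine ⟨X_ne_zero _, MonomialOrder.degree_X, (rank_X_castSucc_le ν).trans h2.ge,
            fun i _ => ?_⟩
          rw [rank_C]
          omega) f hf
  have hr0 : r = 0 := by
    rw [← support_eq_empty]
    exact Finset.eq_empty_of_forall_notMem hr
  rw [hr0, add_zero] at hQ
  exact ⟨Q, hQ, hQr⟩

theorem cutIdeal_eq_top (hgen : GenericKinematics p M) (hS : 6 ≤ S.card) (hS' : S.Nonempty) :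
    cutIdeal p M S hS' e = ⊤ := by
  obtain ⟨⟨h, hh⟩, -⟩ := exists_six_combinations hgen hS
  rw [Ideal.eq_top_iff_one, ← map_one (toCut (cutOrigin p S hS') e), ← hh, map_sum]
  refine Ideal.sum_mem _ fun i hi => ?_
  rw [map_mul]
  exact Ideal.mul_mem_left _ _ (Ideal.subset_span ⟨i, hi, rfl⟩)

theorem isGroebnerBasis_top : IsGroebnerBasis ord ⊤ {1} := by
  refine ⟨by simp, by simp, fun f _ _ => ⟨1, by simp, ?_⟩⟩
  rw [MonomialOrder.degree_one]
  exact zero_le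

theorem remainder_eq_zero_of_six_le (hgen : GenericKinematics p M) (hS : 6 ≤ S.card)
    (hS' : S.Nonempty) {f r : LoopPoly}
    (h : IsGroebnerRemainder ord (cutIdeal p M S hS' e) f r) : r = 0 := by
  rw [cutIdeal_eq_top hgen hS] at h
  exact h.eq_of_reduced isGroebnerBasis_top (by simp) (by simp)

/-! ### One step of the recursion -/

theorem exists_isQuadricSystem (hord : IsCutOrder ord) (hgen : GenericKinematics p M)
    (he : IsCutBasis p S e) (hS : S.card ≤ 5) {o : Fin n} (ho : o ∈ S) :
    ∃ E m A c y, IsQuadricSystem ord S (cutDenominator p M e o) E m o A c y := by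
  have h0 : 0 < S.card := Finset.card_pos.2 ⟨o, ho⟩
  have : S.card = 1 ∨ S.card = 2 ∨ S.card = 3 ∨ S.card = 4 ∨ S.card = 5 := by omega
  rcases this with h | h | h | h | h
  · exact ⟨_, exists_isQuadricSystem_one ho he h⟩
  · exact ⟨_, _, exists_isQuadricSystem_two hord ho he h⟩
  · exact ⟨_, _, exists_isQuadricSystem_three hord ho hgen he h⟩
  · exact ⟨_, _, exists_isQuadricSystem_four hord ho hgen he h⟩
  · exact ⟨_, _, exists_isQuadricSystem_five ho hgen he h⟩

/-- The given remainder may come from any Gröbner basis and any quotients; uniqueness identifies it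
with the rank-controlled one. -/
theorem IsQuadricSystem.remainder_mem {ι : Type*} {I : Finset ι} {D : ι → LoopPoly}
    {E : Finset (Fin 4)} {m : Fin 5 →₀ ℕ} {o : ι} {A : Matrix (Fin 4) (Fin 4) ℂ} {c : ℂ}
    {y : Fin 4 → LoopPoly} (h : IsQuadricSystem ord I D E m o A c y) {k : ℕ} {f r : LoopPoly}
    (hf : rank f ≤ k) (hr : IsGroebnerRemainder ord (Ideal.span (D '' (I : Set ι))) f r) :
    rank r ≤ k ∧ ∀ d ∈ r.support, (∀ j ∈ E, d j.castSucc = 0) ∧ ¬ m ≤ d := by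
  obtain ⟨Q, s, hQ, -, hs, hsm⟩ := h.exists_reduction hf
  rw [hr.eq_of_reduced h.isGroebnerBasis (s := s) ?_ fun d hd => h.not_degree_le.2 (hsm d hd)]
  · exact ⟨hs, hsm⟩
  · rw [hQ, add_sub_cancel_right]
    exact Ideal.sum_mem _ fun i hi => Ideal.mul_mem_left _ _ (Ideal.subset_span ⟨i, hi, rfl⟩)

/-- One step of the recursive division, with quotients of controlled rank. -/
theorem exists_step (hord : IsCutOrder ord) (hgen : GenericKinematics p M)
    (he : IsCutBasis p S e) (hS : S.Nonempty) (f : LoopPoly) (hf : rank f ≤ S.card) :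
    ∃ (Δ : LoopPoly) (Q : Fin n → LoopPoly),
      IsGroebnerRemainder ord (cutIdeal p M S hS e) (toCut (cutOrigin p S hS) e f)
        (toCut (cutOrigin p S hS) e Δ) ∧
      f = ∑ i ∈ S, Q i * denominator (p i) (M i) + Δ ∧
      ∀ i ∈ S, rank (Q i) ≤ S.card - 1 := by
  by_cases h6 : 6 ≤ S.card
  · obtain ⟨Q, hQ, hQr⟩ := exists_eq_sum_of_six_le ord hgen h6 hf
    have hG : IsGroebnerBasis ord (cutIdeal p M S hS e) {1} := by
      rw [cutIdeal_eq_top hgen h6]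
      exact isGroebnerBasis_top
    obtain ⟨r, hr⟩ := exists_isGroebnerRemainder hG (toCut (cutOrigin p S hS) e f)
    refine ⟨0, Q, ?_, by rw [add_zero, ← hQ], hQr⟩
    rwa [map_zero, ← remainder_eq_zero_of_six_le hgen h6 hS hr]
  · obtain ⟨E, m, A, c, y, h⟩ := exists_isQuadricSystem (ord := ord) (M := M) hord hgen he
      (by omega) (S.min'_mem hS)
    obtain ⟨ψ, hψ1, hψ2, hψr⟩ := exists_inverse_toCut (cutOrigin p S hS) he.linearIndependent'
    obtain ⟨Q, s, hQ, hQr, -, hsm⟩ :=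
      h.exists_reduction ((rank_toCut_le (cutOrigin p S hS) e f).trans hf)
    obtain ⟨r, hr⟩ := exists_isGroebnerRemainder h.isGroebnerBasis (toCut (cutOrigin p S hS) e f)
    have hrs : r = s := by
      refine hr.eq_of_reduced h.isGroebnerBasis ?_ fun d hd => h.not_degree_le.2 (hsm d hd)
      rw [hQ, add_sub_cancel_right]
      exact Ideal.sum_mem _ fun i hi => Ideal.mul_mem_left _ _ (Ideal.subset_span ⟨i, hi, rfl⟩)
    -- The division is carried out in cut variables; the inverse substitution returns it to loop
    -- variables without raising ranks.
    refine ⟨ψ s, fun i => ψ (Q i), ?_, ?_, fun i hi => (hψr _).trans (hQr i hi)⟩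
    · rw [hψ2, ← hrs]
      exact hr
    · rw [← hψ1 f, hQ, map_add, map_sum]
      congr 1
      refine Finset.sum_congr rfl fun i _ => ?_
      rw [map_mul, cutDenominator]
      exact congrArg _ (hψ1 _)

end

section

variable {n : ℕ} {p : Fin n → Momentum} {M : Fin n → ℂ} {S : Finset (Fin n)}
  {e : Finset (Fin n) → Fin 4 → Momentum} {ord : MonomialOrder (Fin 5)} {N₀ : LoopPoly}
  {N Δ : Finset (Fin n) → LoopPoly} {Q : Finset (Fin n) → Fin n → LoopPoly}

/-! ### Existence of a recursive division -/

/-- The numerators of the recursive division, for given quotients `q S f κ` of the division of a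
numerator `f` at the cut `S`. -/
def numerator (q : Finset (Fin n) → LoopPoly → Fin n → LoopPoly) (N₀ : LoopPoly)
    (T : Finset (Fin n)) : LoopPoly :=
  if T = Finset.univ then N₀ else
    ∑ κ ∈ (Finset.univ \ T).attach, q (insert κ.1 T) (numerator q N₀ (insert κ.1 T)) κ.1
termination_by (Finset.univ \ T).card
decreasing_by
  refine Finset.card_lt_card (Finset.ssubset_iff_of_subset ?_ |>.2 ⟨κ.1, κ.2, by simp⟩)
  exact Finset.sdiff_subset_sdiff le_rfl (Finset.subset_insert _ _)

theorem numerator_univ (q : Finset (Fin n) → LoopPoly → Fin n → LoopPoly) (N₀ : LoopPoly) :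
    numerator q N₀ Finset.univ = N₀ := by
  rw [numerator, if_pos rfl]

theorem numerator_of_ne_univ (q : Finset (Fin n) → LoopPoly → Fin n → LoopPoly) (N₀ : LoopPoly)
    {T : Finset (Fin n)} (hT : T ≠ Finset.univ) : numerator q N₀ T =
      ∑ κ ∈ Finset.univ \ T, q (insert κ T) (numerator q N₀ (insert κ T)) κ := by
  rw [numerator, if_neg hT,
    Finset.sum_attach (Finset.univ \ T) fun κ => q (insert κ T) (numerator q N₀ (insert κ T)) κ]

/-- Pinching a denominator lowers the cardinality and the rank bound by one together, so the bound
descends from the full set. -/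
theorem rank_numerator_le {q : Finset (Fin n) → LoopPoly → Fin n → LoopPoly}
    (hq : ∀ S : Finset (Fin n), ∀ f, rank f ≤ S.card → ∀ κ ∈ S, rank (q S f κ) ≤ S.card - 1)
    (hN₀ : rank N₀ ≤ n) (T : Finset (Fin n)) : rank (numerator q N₀ T) ≤ T.card := by
  by_cases hT : T = Finset.univ
  · rw [hT, numerator_univ, Finset.card_univ, Fintype.card_fin]
    exact hN₀
  · rw [numerator_of_ne_univ q N₀ hT]
    refine rank_sum_le _ fun κ hκ => ?_
    have hκT : κ ∉ T := (Finset.mem_sdiff.1 hκ).2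
    have := hq (insert κ T) _ (rank_numerator_le hq hN₀ (insert κ T)) κ (Finset.mem_insert_self _ _)
    rwa [Finset.card_insert_of_notMem hκT, Nat.add_sub_cancel] at this
termination_by (Finset.univ \ T).card
decreasing_by
  refine Finset.card_lt_card (Finset.ssubset_iff_of_subset ?_ |>.2 ⟨κ, hκ, by simp⟩)
  exact Finset.sdiff_subset_sdiff le_rfl (Finset.subset_insert _ _)

theorem exists_isIntegrandReduction (hgen : GenericKinematics p M)
    (he : ∀ S : Finset (Fin n), S.Nonempty → IsCutBasis p S (e S)) (hord : IsCutOrder ord)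
    (hN₀ : rank N₀ ≤ n) : ∃ (N Δ : Finset (Fin n) → LoopPoly)
      (Q : Finset (Fin n) → Fin n → LoopPoly), IsIntegrandReduction p M e ord N₀ N Δ Q := by
  -- Stated for every `S` and `f`, with the rank bound as a premise, so that quotients can be chosen
  -- before the numerators are defined; the empty cut and numerators of too high rank receive zero.
  have hstep : ∀ (S : Finset (Fin n)) (f : LoopPoly), ∃ (r : LoopPoly) (Q : Fin n → LoopPoly),
      rank f ≤ S.card → (∀ hS : S.Nonempty,
      IsGroebnerRemainder ord (cutIdeal p M S hS (e S)) (toCut (cutOrigin p S hS) (e S) f)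
        (toCut (cutOrigin p S hS) (e S) r) ∧
      f = ∑ i ∈ S, Q i * denominator (p i) (M i) + r) ∧ ∀ i ∈ S, rank (Q i) ≤ S.card - 1 := by
    intro S f
    by_cases hf : rank f ≤ S.card
    · rcases S.eq_empty_or_nonempty with rfl | hS
      · exact ⟨0, 0, fun _ => ⟨fun hS => absurd hS (by simp), by simp⟩⟩
      · obtain ⟨r, Q, h1, h2, h3⟩ := exists_step hord hgen (he S hS) hS f hf
        exact ⟨r, Q, fun _ => ⟨fun _ => ⟨h1, h2⟩, h3⟩⟩
    · exact ⟨0, 0, fun h => absurd h hf⟩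
  choose r q hq using hstep
  have hrank := rank_numerator_le (q := q) (fun S f hf => (hq S f hf).2) hN₀
  refine ⟨numerator q N₀, fun S => r S (numerator q N₀ S), fun S => q S (numerator q N₀ S),
    numerator_univ q N₀, fun S hS => ?_, fun S hS => ?_, fun T hT => numerator_of_ne_univ q N₀ hT,
    hrank⟩
  · exact ((hq S _ (hrank S)).1 hS).1
  · exact ((hq S _ (hrank S)).1 hS).2

/-! ### Properties of every recursive division -/

namespace IsIntegrandReduction

theorem residue_eq_zero (h : IsIntegrandReduction p M e ord N₀ N Δ Q)
    (hgen : GenericKinematics p M)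
    (he : ∀ S : Finset (Fin n), S.Nonempty → IsCutBasis p S (e S)) (hS : 6 ≤ S.card) :
    Δ S = 0 := by
  have hS' : S.Nonempty := Finset.card_pos.1 (by omega)
  refine toCut_injective (cutOrigin p S hS') (he S hS').linearIndependent' ?_
  rw [map_zero]
  exact remainder_eq_zero_of_six_le hgen hS hS' (h.division S hS')

theorem rank_toCut_le (h : IsIntegrandReduction p M e ord N₀ N Δ Q) (hS : S.Nonempty) :
    rank (toCut (cutOrigin p S hS) (e S) (N S)) ≤ S.card :=
  (OneLoop.rank_toCut_le _ _ _).trans (h.rank_le S)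

/-- The leading monomial of a single denominator has weight two, whereas the numerator has rank at
most one and is already reduced. -/
theorem numerator_eq_residue (h : IsIntegrandReduction p M e ord N₀ N Δ Q)
    (he : ∀ S : Finset (Fin n), S.Nonempty → IsCutBasis p S (e S)) (hS : S.card = 1) :
    N S = Δ S := by
  have hS' : S.Nonempty := Finset.card_pos.1 (by omega)
  obtain ⟨m, A, c, y, hsys⟩ := exists_isQuadricSystem_one (ord := ord) (M := M) (S.min'_mem hS')
    (he S hS') hS
  refine toCut_injective (cutOrigin p S hS') (he S hS').linearIndependent' ?_
  refine ((h.division S hS').eq_of_reduced hsys.isGroebnerBasis (by simp) fun d hd => ?_).symm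
  refine hsys.not_degree_le.2 ⟨by simp, fun hm => ?_⟩
  have h1 : wt (d - m) + wt m = wt d := by
    rw [wt, wt, ← map_add, tsub_add_cancel_of_le hm]
  have h2 := hsys.wt_degree
  have h3 := (wt_le_rank hd).trans (h.rank_toCut_le hS')
  omega

/-- At a one-point cut the numerator equals its residue, so the quotient times the nonzero
denominator is zero. Every contribution to the empty cut therefore vanishes. -/
theorem numerator_empty (h : IsIntegrandReduction p M e ord N₀ N Δ Q) (hn : 0 < n)
    (he : ∀ S : Finset (Fin n), S.Nonempty → IsCutBasis p S (e S)) : N ∅ = 0 := by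
  have hne : (∅ : Finset (Fin n)) ≠ Finset.univ := by
    intro h0
    have := Finset.mem_univ (⟨0, hn⟩ : Fin n)
    rw [← h0] at this
    simp at this
  rw [h.collect ∅ hne]
  refine Finset.sum_eq_zero fun κ _ => ?_
  have hκ : (insert κ ∅ : Finset (Fin n)) = {κ} := rfl
  rw [hκ]
  have h1 := h.pinch {κ} (by simp)
  rw [h.numerator_eq_residue he (by simp), Finset.sum_singleton] at h1
  have h2 : Q {κ} κ * denominator (p κ) (M κ) = 0 := by simpa using h1
  refine (mul_eq_zero.1 h2).resolve_right fun h0 => ?_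
  obtain ⟨m, A, c, y, hsys⟩ := exists_isQuadricSystem_one (ord := ord) (M := M)
    (Finset.mem_singleton_self κ) (he {κ} (by simp)) (by simp)
  refine hsys.quadric_ne_zero ?_
  rw [← hsys.eliminate_origin, cutDenominator, h0, map_zero, map_zero]

/-- Dividing the pinch identity at `S` by the denominators of `S` turns each quotient into a term
over `S.erase κ`. Regrouped by `T = S.erase κ`, these terms are the lower integrands, so everything
cancels except the full set and the empty set. -/
theorem sum_residues (h : IsIntegrandReduction p M e ord N₀ N Δ Q) (z : Fin 5 → ℂ)
    (hz : ∀ i, eval z (denominator (p i) (M i)) ≠ 0) :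
    ∑ S ∈ Finset.univ.erase ∅, eval z (Δ S) / ∏ i ∈ S, eval z (denominator (p i) (M i)) =
      eval z N₀ / ∏ i, eval z (denominator (p i) (M i)) - eval z (N ∅) := by
  set d : Fin n → ℂ := fun i => eval z (denominator (p i) (M i))
  let w : Finset (Fin n) → ℂ := fun S => ∏ i ∈ S, d i
  let G : Finset (Fin n) → Fin n → ℂ := fun S κ => eval z (Q S κ) / w (S.erase κ)
  have h1 : ∀ S ∈ Finset.univ.erase (∅ : Finset (Fin n)),
      eval z (Δ S) / w S = eval z (N S) / w S - ∑ κ ∈ S, G S κ := by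
    intro S hS
    rw [h.pinch S (Finset.nonempty_iff_ne_empty.2 (Finset.mem_erase.1 hS).1), map_add, map_sum,
      add_div, Finset.sum_div]
    have : ∀ κ ∈ S, eval z (Q S κ * denominator (p κ) (M κ)) / w S = G S κ := by
      intro κ hκ
      have hw : w S = w (S.erase κ) * d κ := (Finset.prod_erase_mul S d hκ).symm
      rw [map_mul, hw]
      exact mul_div_mul_right _ _ (hz κ)
    rw [Finset.sum_congr rfl this]
    ring
  have h2 : ∀ T ∈ Finset.univ.erase (Finset.univ : Finset (Fin n)),
      ∑ κ ∈ Finset.univ \ T, G (insert κ T) κ = eval z (N T) / w T := by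
    intro T hT
    rw [h.collect T (Finset.mem_erase.1 hT).1, map_sum, Finset.sum_div]
    refine Finset.sum_congr rfl fun κ hκ => ?_
    simp only [G]
    rw [Finset.erase_insert (Finset.mem_sdiff.1 hκ).2]
  -- Reindexing by the bijection `(S, κ) ↦ (S.erase κ, κ)` from pairs with `κ ∈ S` to pairs with `κ
  -- ∉ T`.
  have h3 : ∑ S : Finset (Fin n), ∑ κ ∈ S, G S κ =
      ∑ T : Finset (Fin n), ∑ κ ∈ Finset.univ \ T, G (insert κ T) κ := by
    refine (Finset.sum_comm' (t' := Finset.univ)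
      (s' := fun κ => Finset.univ.filter fun S : Finset (Fin n) => κ ∈ S) (by simp)).trans
      (Eq.trans ?_ (Finset.sum_comm' (t' := Finset.univ)
        (s' := fun κ => Finset.univ.filter fun T : Finset (Fin n) => κ ∉ T) (by simp)).symm)
    refine Finset.sum_congr rfl fun κ _ => ?_
    refine Finset.sum_nbij' (fun S => S.erase κ) (fun T => insert κ T) (by simp) (by simp) ?_ ?_ ?_
    · intro S hS
      exact Finset.insert_erase (by simpa using hS)
    · intro T hT
      exact Finset.erase_insert (by simpa using hT)
    · intro S hS
      rw [Finset.insert_erase (by simpa using hS)]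
  have h4 := Finset.add_sum_erase Finset.univ (fun S => ∑ κ ∈ S, G S κ)
    (Finset.mem_univ (∅ : Finset (Fin n)))
  have h5 := Finset.add_sum_erase Finset.univ
    (fun T : Finset (Fin n) => ∑ κ ∈ Finset.univ \ T, G (insert κ T) κ)
    (Finset.mem_univ (Finset.univ : Finset (Fin n)))
  have h6 := Finset.add_sum_erase Finset.univ (fun S => eval z (N S) / w S)
    (Finset.mem_univ (∅ : Finset (Fin n)))
  have h7 := Finset.add_sum_erase Finset.univ (fun S => eval z (N S) / w S)
    (Finset.mem_univ (Finset.univ : Finset (Fin n)))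
  rw [Finset.sum_congr rfl h2] at h5
  change ∑ S ∈ _, eval z (Δ S) / w S = eval z N₀ / w Finset.univ - eval z (N ∅)
  rw [Finset.sum_congr rfl h1, Finset.sum_sub_distrib]
  simp only [Finset.sum_empty, zero_add, Finset.sdiff_self, h.start] at h4 h5 h6 h7
  have h8 : eval z (N ∅) / w ∅ = eval z (N ∅) := by simp [w]
  rw [h8] at h6
  linear_combination h6 - h7 - h4 - h3 + h5

end IsIntegrandReduction

theorem sum_powersetCard_eq {F : Finset (Fin n) → ℂ} (hF : ∀ S, 6 ≤ S.card → F S = 0) :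
    ∑ k ∈ Finset.Icc 1 5, ∑ S ∈ Finset.powersetCard k Finset.univ, F S =
      ∑ S ∈ Finset.univ.erase ∅, F S := by
  simp only [Finset.powersetCard_eq_filter, Finset.powerset_univ, Finset.sum_filter]
  rw [Finset.sum_comm]
  refine (Finset.sum_erase (a := ∅) _ ?_).symm.trans (Finset.sum_congr rfl fun S hS => ?_)
  · rw [Finset.sum_ite_eq, if_neg (by simp)]
  · rw [Finset.sum_ite_eq]
    split_ifs with h
    · rfl
    · refine (hF S ?_).symm
      have : 0 < S.card := Finset.card_pos.2
        (Finset.nonempty_iff_ne_empty.2 (Finset.mem_erase.1 hS).1)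
      rw [Finset.mem_Icc] at h
      omega

end

end

end OneLoop

/-! ### The decomposition and the shapes of the residues -/

theorem mainTheorem4 (n : ℕ) (hn : 0 < n)
    (p : Fin n → OneLoop.Momentum) (M : Fin n → ℂ)
    (hgen : OneLoop.GenericKinematics p M)
    (e : Finset (Fin n) → Fin 4 → OneLoop.Momentum)
    (he : ∀ S : Finset (Fin n), S.Nonempty → OneLoop.IsCutBasis p S (e S))
    (ord : MonomialOrder (Fin 5)) (hord : OneLoop.IsCutOrder ord)
    (N₀ : OneLoop.LoopPoly) (hN₀ : OneLoop.rank N₀ ≤ n) :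
    (∃ (N Δ : Finset (Fin n) → OneLoop.LoopPoly) (Q : Finset (Fin n) → Fin n → OneLoop.LoopPoly),
      OneLoop.IsIntegrandReduction p M e ord N₀ N Δ Q) ∧
    ∀ (N Δ : Finset (Fin n) → OneLoop.LoopPoly) (Q : Finset (Fin n) → Fin n → OneLoop.LoopPoly),
      OneLoop.IsIntegrandReduction p M e ord N₀ N Δ Q →
      (∀ z : Fin 5 → ℂ,
        (∀ i, MvPolynomial.eval z (OneLoop.denominator (p i) (M i)) ≠ 0) →
        MvPolynomial.eval z N₀ / ∏ i, MvPolynomial.eval z (OneLoop.denominator (p i) (M i)) =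
          ∑ k ∈ Finset.Icc 1 5, ∑ S ∈ Finset.powersetCard k Finset.univ,
            MvPolynomial.eval z (Δ S) /
              ∏ i ∈ S, MvPolynomial.eval z (OneLoop.denominator (p i) (M i))) ∧
      (∀ S : Finset (Fin n), 6 ≤ S.card → Δ S = 0) ∧
      (∀ (S : Finset (Fin n)) (hS : S.Nonempty), S.card = 5 →
        ∃ c : ℂ, OneLoop.toCut (OneLoop.cutOrigin p S hS) (e S) (Δ S) = MvPolynomial.C c) ∧
      (∀ (S : Finset (Fin n)) (hS : S.Nonempty), S.card = 4 →
        ∃ c : Fin 5 → ℂ, OneLoop.toCut (OneLoop.cutOrigin p S hS) (e S) (Δ S) =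
          let x₄ : OneLoop.LoopPoly := MvPolynomial.X 3
          let μsq : OneLoop.LoopPoly := MvPolynomial.X 4
          let c' : Fin 5 → OneLoop.LoopPoly := fun j => MvPolynomial.C (c j)
          c' 0 + c' 1 * x₄ + μsq * (c' 2 + c' 3 * x₄ + μsq * c' 4)) ∧
      (∀ (S : Finset (Fin n)) (hS : S.Nonempty), S.card = 3 →
        ∃ c : Fin 10 → ℂ, OneLoop.toCut (OneLoop.cutOrigin p S hS) (e S) (Δ S) =
          let x₃ : OneLoop.LoopPoly := MvPolynomial.X 2
          let x₄ : OneLoop.LoopPoly := MvPolynomial.X 3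
          let μsq : OneLoop.LoopPoly := MvPolynomial.X 4
          let c' : Fin 10 → OneLoop.LoopPoly := fun j => MvPolynomial.C (c j)
          c' 0 + c' 1 * x₃ + c' 2 * x₃ ^ 2 + c' 3 * x₃ ^ 3
            + c' 4 * x₄ + c' 5 * x₄ ^ 2 + c' 6 * x₄ ^ 3
            + μsq * (c' 7 + c' 8 * x₃ + c' 9 * x₄)) ∧
      (∀ (S : Finset (Fin n)) (hS : S.Nonempty), S.card = 2 →
        ∃ c : Fin 10 → ℂ, OneLoop.toCut (OneLoop.cutOrigin p S hS) (e S) (Δ S) =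
          let x₂ : OneLoop.LoopPoly := MvPolynomial.X 1
          let x₃ : OneLoop.LoopPoly := MvPolynomial.X 2
          let x₄ : OneLoop.LoopPoly := MvPolynomial.X 3
          let μsq : OneLoop.LoopPoly := MvPolynomial.X 4
          let c' : Fin 10 → OneLoop.LoopPoly := fun j => MvPolynomial.C (c j)
          c' 0 + c' 1 * x₂ + c' 2 * x₃ + c' 3 * x₄
            + c' 4 * x₂ ^ 2 + c' 5 * x₃ ^ 2 + c' 6 * x₄ ^ 2
            + c' 7 * x₂ * x₃ + c' 8 * x₂ * x₄ + c' 9 * μsq) ∧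
      (∀ (S : Finset (Fin n)) (hS : S.Nonempty), S.card = 1 →
        N S = Δ S ∧
        ∃ β : Fin 5 → ℂ, OneLoop.toCut (OneLoop.cutOrigin p S hS) (e S) (Δ S) =
          let x : Fin 4 → OneLoop.LoopPoly := fun j => MvPolynomial.X j.castSucc
          let β' : Fin 5 → OneLoop.LoopPoly := fun j => MvPolynomial.C (β j)
          β' 0 + ∑ j : Fin 4, β' j.succ * x j) := by
  refine ⟨OneLoop.exists_isIntegrandReduction hgen he hord hN₀, fun N Δ Q h => ⟨fun z hz => ?_,
    fun S hS => h.residue_eq_zero hgen he hS, fun S hS hk => ?_, fun S hS hk => ?_,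
    fun S hS hk => ?_, fun S hS hk => ?_, fun S hS hk => ?_⟩⟩
  · rw [OneLoop.sum_powersetCard_eq fun S hS => by rw [h.residue_eq_zero hgen he hS]; simp,
      h.sum_residues z hz, h.numerator_empty hn he, map_zero, sub_zero]
  · obtain ⟨A, c, y, hsys⟩ := OneLoop.exists_isQuadricSystem_five (ord := ord) (S.min'_mem hS) hgen
      (he S hS) hk
    exact OneLoop.shape_five (hsys.remainder_mem (h.rank_toCut_le hS) (h.division S hS)).2
  · obtain ⟨A, c, y, hsys⟩ := OneLoop.exists_isQuadricSystem_four hord (S.min'_mem hS) hgen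
      (he S hS) hk
    obtain ⟨hr, hs⟩ := hsys.remainder_mem (h.rank_toCut_le hS) (h.division S hS)
    exact OneLoop.shape_four (hr.trans hk.le) hs
  · obtain ⟨A, c, y, hsys⟩ := OneLoop.exists_isQuadricSystem_three hord (S.min'_mem hS) hgen
      (he S hS) hk
    obtain ⟨hr, hs⟩ := hsys.remainder_mem (h.rank_toCut_le hS) (h.division S hS)
    exact OneLoop.shape_three (hr.trans hk.le) hs
  · obtain ⟨A, c, y, hsys⟩ := OneLoop.exists_isQuadricSystem_two (M := M) hord (S.min'_mem hS)
      (he S hS) hk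
    obtain ⟨hr, hs⟩ := hsys.remainder_mem (h.rank_toCut_le hS) (h.division S hS)
    exact OneLoop.shape_two (hr.trans hk.le) hs
  · have hN := h.numerator_eq_residue he hk
    refine ⟨hN, OneLoop.shape_one ?_⟩
    rw [← hN]
    exact (h.rank_toCut_le hS).trans hk.le
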